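/- A \emph{tree} here is a finite rooted unordered tree whose vertices are labelled by distinct positive integers; it is \emph{increasing} if every non-root vertex has a larger label than its father. Let $T_1,T_2$ be increasing trees with disjoint vertex-sets and let $v_1,v_2$ be vertices of $T_1,T_2$ with $v_1>v_2$. The \emph{splice} $\mathrm{spl}(T_1,v_1;T_2,v_2)$ is the increasing tree on the union of the two vertex-sets obtained as follows: delete, for $j=1,2$, the edges of the path of $T_j$ from its root to $v_j$; this leaves one component rooted at each vertex of the two paths; keep these components unchanged, and join the vertices of both paths into a single path on which the labels increase away from the root. Let $r\ge 2$ and let $\pi$ be a partition of $\{1,\dots,r\}$ having $\{1\}$ as a block. Write $k=|\pi|$ and let $\pi_1,\dots,\pi_k$ be its blocks with maxima $\mu_1<\dots<\mu_k$, so that $\pi_1=\{1\}$ and $k\ge2$. Let $$\mathcal C(\pi)=\{(c_2,\dots,c_{k-1}) : c_i\in\mathbb Z,\ 1\le c_i\le\mu_i \text{ for } 2\le i\le k-1\}$$ (a single empty tuple if $k=2$), and let $\mathcal E(\pi)$ be the set of increasing trees $T$ with vertex-set $\{1,\dots,r\}$ such that for all $i<j$ in a common block of $\pi$, $i$ is an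 ancestor of $j$ in $T$. With formal variables $x_1,\dots,x_r$, put $$\kappa(T)=\prod_{i=1}^r x_i^{\sigma_i(T)},\qquad \omega(c,\pi)=\frac{x_{c_2}\cdots x_{c_{k-1}}}{x_{\mu_2}\cdots x_{\mu_k}}\prod_{i=1}^r x_i,$$ where $\sigma_i(T)$ is the number of sons of $i$ in $T$. For $c\in\mathcal C(\pi)$ define the tree $\psi_\pi(c)$ by the following procedure. Start with $\tau_\ell$ equal to the increasing path with vertex-set $\pi_\ell$, for $\ell=1,\dots,k$, and with $\nu=1$. For $i=2,\dots,k-1$ in this order: if $c_i$ is a vertex of $\tau_1$ or of $\tau_i$, replace $\tau_1$ by $\mathrm{spl}(\tau_i,\mu_i;\tau_1,\nu)$, discard $\tau_i$, and then set $\nu=c_i$; otherwise $c_i$ is a vertex of $\tau_j$ for exactly one $j>i$; replace this $\tau_j$ by $\mathrm{spl}(\tau_i,\mu_i;\tau_j,c_i)$ and discard $\tau_i$. Finally set $\psi_\pi(c)=\mathrm{spl}(\tau_k,\mu_k;\tau_1,\nu)$. \textbf{Theorem.} For every $r\ge2$ and every partition $\pi$ of $\{1,\dots,r\}$ having $\{1\}$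 as a block, $\psi_\pi$ is a bijection from $\mathcal C(\pi)$ to $\mathcal E(\pi)$, and $\kappa(\psi_\pi(c))=\omega(c,\pi)$ for every $c\in\mathcal C(\pi)$. -/

import Mathlib

open Finset

/-- A finite rooted tree whose vertices are labelled by positive integers, given by its vertex-set
and its father function `v ↦ f_T(v)`, with `f_T(v) = 0` when `v` is the root. The value `0` is also
taken off the vertex-set, so that the data is determined by the tree. The sons of a vertex form a
set, i.e. the tree is unordered. The conditions that make the data a tree are in
`LTree.IsIncreasingTree`. -/
@[ext]
structure LTree where
  verts : Finset ℕ
  father : ℕ → ℕ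

namespace LTree

/-- `T` is an unordered increasing tree: the labels are positive, there is exactly one root, and
the father of every other vertex is a vertex with a smaller label (thus every vertex is joined to
the root by iterating the father function, and there is no cycle). -/
def IsIncreasingTree (T : LTree) : Prop :=
  (∀ v ∈ T.verts, 0 < v) ∧
  (∀ v, v ∉ T.verts → T.father v = 0) ∧
  (∃! a, a ∈ T.verts ∧ T.father a = 0) ∧
  (∀ v ∈ T.verts, T.father v ≠ 0 → T.father v ∈ T.verts ∧ T.father v < v)

/-- `u` and `v` are vertices of `T`, and `u` is the father of `v`. -/
def IsFather (T : LTree) (u v : ℕ) : Prop :=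
  u ∈ T.verts ∧ v ∈ T.verts ∧ T.father v = u

/-- `u` is a (proper) ancestor of `v` in `T`. -/
def IsAncestor (T : LTree) (u v : ℕ) : Prop :=
  Relation.TransGen T.IsFather u v

/-- The number `σ_i(T)` of sons of the vertex `i`. -/
def sons (T : LTree) (i : ℕ) : ℕ :=
  (T.verts.filter fun v => T.father v = i).card

open Classical in
/-- The vertices of the maximal chain of `T` from the root to the vertex `v`: the vertex `v`
together with its ancestors. -/
noncomputable def chainTo (T : LTree) (v : ℕ) : Finset ℕ :=
  T.verts.filter fun a => a = v ∨ T.IsAncestor a v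

/-- The largest element of `K` smaller than `x`, and `0` if there is none (`K` being a set of
positive integers). -/
def pred (K : Finset ℕ) (x : ℕ) : ℕ :=
  (K.filter fun y => y < x).sup id

/-- The increasing chain with vertex-set `B`. -/
def ofChain (B : Finset ℕ) : LTree where
  verts := B
  father x := if x ∈ B then pred B x else 0

/-- The splice of `T₁` and `T₂` (with disjoint vertex-sets) with splicing vertices `v₁` of `T₁` and
`v₂` of `T₂`, `v₁ > v₂`. Cut the edges of the chain of `Tᵢ` from the root to `vᵢ`, for `i = 1, 2`;
this leaves one component rooted at each vertex of the two chains. Inside these components nothing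
changes; the roots of all of them, i.e. the vertices of both chains, are arranged into a single
increasing chain. -/
noncomputable def splice (T₁ : LTree) (v₁ : ℕ) (T₂ : LTree) (v₂ : ℕ) : LTree where
  verts := T₁.verts ∪ T₂.verts
  father x :=
    if x ∈ T₁.chainTo v₁ ∪ T₂.chainTo v₂ then pred (T₁.chainTo v₁ ∪ T₂.chainTo v₂) x
    else if x ∈ T₁.verts then T₁.father x
    else T₂.father x

end LTree

namespace SetPartition

variable {S : Finset ℕ}

/-- The number `|π|` of blocks. -/
def numBlocks (π : Finpartition S) : ℕ := π.parts.card

/-- `μ_i`: the `i`-th smallest among the maxima of the blocks of `π`, `i = 1, …, |π|`. -/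
noncomputable def mu (π : Finpartition S) (i : ℕ) : ℕ :=
  Nat.nth (fun m => ∃ B ∈ π.parts, IsGreatest (B : Set ℕ) m) (i - 1)

/-- `π_i`: the block of `π` with maximum `μ_i`, `i = 1, …, |π|`. -/
noncomputable def block (π : Finpartition S) (i : ℕ) : Finset ℕ := π.part (mu π i)

/-- `E(π)`: the unordered increasing trees `T` on the vertex-set `S` such that every block of `π`
is a subchain of `T`. -/
def treeSet (π : Finpartition S) : Set LTree :=
  {T | T.IsIncreasingTree ∧ T.verts = S ∧
    ∀ B ∈ π.parts, ∀ i ∈ B, ∀ j ∈ B, i < j → T.IsAncestor i j}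

/-- `C(π)`: the tuples `(c_2, …, c_{|π|-1})` with `1 ≤ c_i ≤ μ_i`; the entry `c_i` is the value of
the tuple at the index `i - 2` of `Fin (|π| - 2)`. -/
def tupleSet (π : Finpartition S) : Set (Fin (numBlocks π - 2) → ℕ) :=
  {c | ∀ n, 1 ≤ c n ∧ c n ≤ mu π (n + 2)}

/-- Stage `i` of the construction, with `c = c_i`, acting on the components `τ_1, τ_i, …, τ_{|π|}`
and on the integer `ν`. The component `τ_i` is then omitted, in that its value is not used in the
later stages. -/
noncomputable def stage (π : Finpartition S) (i c : ℕ) (s : (ℕ → LTree) × ℕ) :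
    (ℕ → LTree) × ℕ :=
  if c ∈ (s.1 1).verts ∪ (s.1 i).verts then
    (Function.update s.1 1 ((s.1 i).splice (mu π i) (s.1 1) s.2), c)
  else
    (fun j => if i < j ∧ c ∈ (s.1 j).verts then (s.1 i).splice (mu π i) (s.1 j) c else s.1 j, s.2)

/-- The components and the integer `ν` after Stage `n + 1`, for `n = 0, …, |π| - 2`. At Stage `1`
the components are the chains of the blocks and `ν = 1`. -/
noncomputable def state (π : Finpartition S) (c : Fin (numBlocks π - 2) → ℕ) :
    ℕ → (ℕ → LTree) × ℕ
  | 0 => (fun l => LTree.ofChain (block π l), 1)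
  | n + 1 => if h : n < numBlocks π - 2 then stage π (n + 2) (c ⟨n, h⟩) (state π c n)
      else state π c n

/-- The map `ψ_π`: run the Stages `1, …, |π| - 1`, then splice the two remaining trees. -/
noncomputable def psi (π : Finpartition S) (c : Fin (numBlocks π - 2) → ℕ) : LTree :=
  let s := state π c (numBlocks π - 2)
  (s.1 (numBlocks π)).splice (mu π (numBlocks π)) (s.1 1) s.2

/-- The field of rational functions in the formal variables `x_i`. -/
abbrev RatField : Type := FractionRing (MvPolynomial ℕ ℤ)

/-- The formal variable `x_i`. -/
noncomputable def x (i : ℕ) : RatField :=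
  algebraMap (MvPolynomial ℕ ℤ) RatField (MvPolynomial.X i)

/-- `κ(T) = ∏ x_i ^ σ_i(T)`, the product over the vertices `i` of `T`. -/
noncomputable def kappa (T : LTree) : RatField := ∏ i ∈ T.verts, x i ^ T.sons i

/-- `ω(c, π) = (x_{c_2} ⋯ x_{c_{|π|-1}}) / (x_{μ_2} ⋯ x_{μ_{|π|}}) * ∏_{i ∈ S} x_i`. -/
noncomputable def omega (π : Finpartition S) (c : Fin (numBlocks π - 2) → ℕ) : RatField :=
  (∏ n, x (c n)) / (∏ i ∈ Finset.Icc 2 (numBlocks π), x (mu π i)) * ∏ i ∈ S, x i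

end SetPartition

/-! ### Chains, predecessors and meets in an increasing tree -/

namespace LTree

variable {T T₁ T₂ : LTree} {a v v₁ v₂ w x y : ℕ}

/-! Every stage, the final splice included, has one shape: `τ_i` is spliced at `μ_i` into a
remaining component `τ_j` at some vertex `u < μ_i` (`IsSpliceStep`, `IsValid.stage_spec`,
`psi_step`). Bijectivity follows once such a step can be undone in exactly one way:
`IsForest.step_unique` yields injectivity and `IsForest.exists_step` surjectivity, by recursion
backwards through the stages.

The difficulty is to tell which vertices of the spliced tree `T` come from `τ_i`. Put `v = μ_i`.
Cutting the chain to `v` leaves components that the blocks tie together: from `x`, pass to the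
vertex where the chain to `x` leaves the chain to `v`, and then to the maximum of its block. This
self-map `link` fixes `v`; `linkClass` collects the vertices whose block maximum it eventually leads
to `v`, and `T` is `Linked` at `v` if these are all its vertices. If `τ_i` is linked at `μ_i`, the
class of `v` in `T` is exactly the vertex-set of `τ_i` (`Splicing.linkClass_eq`), after which both
trees and `u` can be read off (`Splicing.unique`). Conversely, a proper class can always be cut out
(`IsIncreasingTree.exists_splice`).

The invariant is therefore that `τ_j` is linked at `μ_j` for all `j ≥ i`. It holds trivially for the
chains of the blocks, and splicing respects it in both directions (`Splicing.linked_iff`). For the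
inverse step, the class of `μ_i` in `τ_j` must also omit `μ_j`. If `j = 1`, this holds because the
root `1`, being a singleton block, is fixed by `link`; if `j > i`, it is the orbit argument of
`IsIncreasingTree.notMem_linkClass`.

A step reveals `c_i`: for `j = 1` it is the new `ν`, while `u` is the old one; otherwise `c_i = u`
and `ν` is unchanged. As to weights, a splice multiplies the two weights and adds the factor `x v₂`
(`kappa_splice`), so the product of the weights of all components and of the variable of `ν` gains
exactly the variable of `c_i` at each stage. -/

theorem mem_chainTo : a ∈ T.chainTo v ↔ a ∈ T.verts ∧ (a = v ∨ T.IsAncestor a v) := by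
  simp [chainTo]

theorem IsAncestor.mem_right (h : T.IsAncestor a v) : v ∈ T.verts := by
  obtain ⟨b, -, hb⟩ := Relation.TransGen.tail'_iff.1 h
  exact hb.2.1

theorem chainTo_eq_empty (h : v ∉ T.verts) : T.chainTo v = ∅ := by
  ext a
  simp only [mem_chainTo, notMem_empty, iff_false]
  rintro ⟨ha, rfl | h'⟩
  · exact h ha
  · exact h h'.mem_right

theorem chainTo_subset : T.chainTo v ⊆ T.verts := fun _ h => (mem_chainTo.1 h).1

theorem mem_verts_of_mem_chainTo (h : a ∈ T.chainTo v) : v ∈ T.verts := by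
  by_contra hv
  simp [chainTo_eq_empty hv] at h

theorem self_mem_chainTo (h : v ∈ T.verts) : v ∈ T.chainTo v := mem_chainTo.2 ⟨h, Or.inl rfl⟩

theorem le_pred {K : Finset ℕ} (hy : y ∈ K) (h : y < x) : y ≤ pred K x :=
  Finset.le_sup (f := id) (mem_filter.2 ⟨hy, h⟩)

theorem pred_spec (K : Finset ℕ) (x : ℕ) :
    (pred K x ∈ K ∧ pred K x < x) ∨ (pred K x = 0 ∧ ∀ y ∈ K, x ≤ y) := by
  rcases (K.filter fun y => y < x).eq_empty_or_nonempty with h | h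
  · right
    refine ⟨by simp [pred, h], fun y hy => ?_⟩
    by_contra hlt
    have : y ∈ K.filter fun y => y < x := mem_filter.2 ⟨hy, not_le.1 hlt⟩
    simp [h] at this
  · left
    obtain ⟨i, hi, e⟩ := Finset.exists_mem_eq_sup _ h id
    have : pred K x = i := e
    rw [this]
    exact mem_filter.1 hi

theorem pred_eq {K : Finset ℕ} (hy : y ∈ K) (h : y < x) (hmax : ∀ z ∈ K, z < x → z ≤ y) :
    pred K x = y := by
  refine le_antisymm ?_ (le_pred hy h)
  rcases pred_spec K x with h' | h'
  · exact hmax _ h'.1 h'.2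
  · omega

theorem pred_eq_zero {K : Finset ℕ} (h : ∀ y ∈ K, x ≤ y) : pred K x = 0 := by
  rcases pred_spec K x with h' | h'
  · have := h _ h'.1; omega
  · exact h'.1

theorem pred_congr {K K' : Finset ℕ} (h : ∀ y, y < x → (y ∈ K ↔ y ∈ K')) :
    pred K x = pred K' x := by
  unfold pred
  congr 1
  ext y
  simp only [mem_filter]
  constructor
  · rintro ⟨h1, h2⟩; exact ⟨(h y h2).1 h1, h2⟩
  · rintro ⟨h1, h2⟩; exact ⟨(h y h2).2 h1, h2⟩

/-- The recursion behind most inductions on labels. It covers the root as well: its father is `0`,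
which is not a vertex of an increasing tree, so that the chain to `0` is empty. -/
theorem chainTo_eq_insert (hx : x ∈ T.verts) :
    T.chainTo x = insert x (T.chainTo (T.father x)) := by
  ext a
  simp only [mem_chainTo, mem_insert, IsAncestor]
  rw [Relation.TransGen.tail'_iff]
  constructor
  · rintro ⟨ha, rfl | ⟨b, hab, hb⟩⟩
    · exact Or.inl rfl
    · right
      refine ⟨ha, ?_⟩
      rw [hb.2.2]
      rcases Relation.reflTransGen_iff_eq_or_transGen.1 hab with h | h
      · exact Or.inl h.symm
      · exact Or.inr h
  · rintro (rfl | ⟨ha, h⟩)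
    · exact ⟨hx, Or.inl rfl⟩
    · refine ⟨ha, Or.inr ⟨T.father x, ?_, ?_⟩⟩
      · rcases h with rfl | h
        · exact Relation.ReflTransGen.refl
        · exact h.to_reflTransGen
      · refine ⟨?_, hx, rfl⟩
        rcases h with rfl | h
        · exact ha
        · exact IsAncestor.mem_right h

namespace IsIncreasingTree

theorem zero_notMem (hT : T.IsIncreasingTree) : 0 ∉ T.verts := fun h => lt_irrefl _ (hT.1 0 h)

theorem father_lt (hT : T.IsIncreasingTree) (hx : x ∈ T.verts) : T.father x < x := by
  by_cases h : T.father x = 0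
  · rw [h]; exact hT.1 x hx
  · exact (hT.2.2.2 x hx h).2

theorem le_of_mem_chainTo (hT : T.IsIncreasingTree) (h : y ∈ T.chainTo x) : y ≤ x := by
  induction x using Nat.strong_induction_on with
  | _ x ih =>
    have hx := mem_verts_of_mem_chainTo h
    rw [chainTo_eq_insert hx, mem_insert] at h
    rcases h with rfl | h
    · exact le_rfl
    · exact (ih _ (hT.father_lt hx) h).trans (hT.father_lt hx).le

theorem chainTo_of_mem (hT : T.IsIncreasingTree) (h : y ∈ T.chainTo x) :
    T.chainTo y = (T.chainTo x).filter (· ≤ y) := by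
  induction x using Nat.strong_induction_on with
  | _ x ih =>
    have hx := mem_verts_of_mem_chainTo h
    have h' := h
    rw [chainTo_eq_insert hx, mem_insert] at h
    rcases h with rfl | h
    · exact (filter_true_of_mem fun z hz => hT.le_of_mem_chainTo hz).symm
    · have hyx : y < x := (hT.le_of_mem_chainTo h).trans_lt (hT.father_lt hx)
      rw [ih _ (hT.father_lt hx) h, chainTo_eq_insert hx, filter_insert, if_neg (by omega)]

theorem chainTo_trans (hT : T.IsIncreasingTree) (h : y ∈ T.chainTo x) (h' : a ∈ T.chainTo y) :
    a ∈ T.chainTo x := by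
  rw [hT.chainTo_of_mem h] at h'
  exact (mem_filter.1 h').1

theorem mem_chainTo_of_le (hT : T.IsIncreasingTree) (h : y ∈ T.chainTo x) (h' : a ∈ T.chainTo x)
    (hle : a ≤ y) : a ∈ T.chainTo y := by
  rw [hT.chainTo_of_mem h]
  exact mem_filter.2 ⟨h', hle⟩

/-- Labels increase along a chain, so the chain as a bare set already determines the father. Trees
can thus be compared through their chains. -/
theorem father_eq_pred (hT : T.IsIncreasingTree) (hx : x ∈ T.verts) :
    T.father x = pred (T.chainTo x) x := by
  symm
  rw [chainTo_eq_insert hx]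
  by_cases h : T.father x = 0
  · rw [h, chainTo_eq_empty hT.zero_notMem]
    exact pred_eq_zero (by simp)
  · obtain ⟨h1, h2⟩ := hT.2.2.2 x hx h
    refine pred_eq (mem_insert_of_mem (self_mem_chainTo h1)) h2 fun z hz hzx => ?_
    rcases mem_insert.1 hz with rfl | hz
    · omega
    · exact hT.le_of_mem_chainTo hz

theorem father_eq_pred_of_mem (hT : T.IsIncreasingTree) (h : x ∈ T.chainTo v) :
    T.father x = pred (T.chainTo v) x := by
  rw [hT.father_eq_pred (chainTo_subset h), hT.chainTo_of_mem h]
  exact pred_congr fun y hy => by simp [hy.le]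

theorem ext_chainTo (h₁ : T₁.IsIncreasingTree) (h₂ : T₂.IsIncreasingTree)
    (hv : T₁.verts = T₂.verts) (h : ∀ x ∈ T₁.verts, T₁.chainTo x = T₂.chainTo x) : T₁ = T₂ := by
  refine LTree.ext hv (funext fun x => ?_)
  by_cases hx : x ∈ T₁.verts
  · rw [h₁.father_eq_pred hx, h₂.father_eq_pred (hv ▸ hx), h x hx]
  · rw [h₁.2.1 x hx, h₂.2.1 x (hv ▸ hx)]

theorem exists_root (hT : T.IsIncreasingTree) : ∃ a ∈ T.verts, ∀ x ∈ T.verts, a ∈ T.chainTo x := by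
  obtain ⟨a, ⟨ha, ha0⟩, huniq⟩ := hT.2.2.1
  refine ⟨a, ha, fun x => ?_⟩
  induction x using Nat.strong_induction_on with
  | _ x ih =>
    intro hx
    by_cases h : T.father x = 0
    · rw [huniq x ⟨hx, h⟩]; exact self_mem_chainTo ha
    · rw [chainTo_eq_insert hx]
      exact mem_insert_of_mem (ih _ (hT.father_lt hx) (hT.2.2.2 x hx h).1)

end IsIncreasingTree

/-- The last common vertex of the chains to `x` and to `v`. -/
noncomputable def meet (T : LTree) (x v : ℕ) : ℕ := (T.chainTo x ∩ T.chainTo v).sup id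

theorem meet_comm (T : LTree) (x v : ℕ) : T.meet x v = T.meet v x := by
  rw [meet, inter_comm, ← meet]

theorem le_meet (h₁ : y ∈ T.chainTo x) (h₂ : y ∈ T.chainTo v) : y ≤ T.meet x v :=
  Finset.le_sup (f := id) (mem_inter.2 ⟨h₁, h₂⟩)

theorem IsIncreasingTree.meet_mem (hT : T.IsIncreasingTree) (hx : x ∈ T.verts) (hv : v ∈ T.verts) :
    T.meet x v ∈ T.chainTo x ∧ T.meet x v ∈ T.chainTo v := by
  obtain ⟨a, -, ha⟩ := hT.exists_root
  obtain ⟨i, hi, e⟩ := Finset.exists_mem_eq_sup _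
    (⟨a, mem_inter.2 ⟨ha x hx, ha v hv⟩⟩ : (T.chainTo x ∩ T.chainTo v).Nonempty) id
  have : T.meet x v = i := e
  rw [this]
  exact mem_inter.1 hi

theorem meet_eq (h₁ : y ∈ T.chainTo x) (h₂ : y ∈ T.chainTo v)
    (h : ∀ z ∈ T.chainTo x, z ∈ T.chainTo v → z ≤ y) : T.meet x v = y :=
  le_antisymm (Finset.sup_le fun z hz => h z (mem_inter.1 hz).1 (mem_inter.1 hz).2) (le_meet h₁ h₂)

namespace IsIncreasingTree

theorem meet_of_mem (hT : T.IsIncreasingTree) (h : x ∈ T.chainTo v) : T.meet x v = x :=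
  meet_eq (self_mem_chainTo (chainTo_subset h)) h fun _ hz _ => hT.le_of_mem_chainTo hz

theorem mem_chainTo_of_le_meet (hT : T.IsIncreasingTree) (hx : x ∈ T.verts) (hv : v ∈ T.verts)
    (h : y ∈ T.chainTo v) (hle : y ≤ T.meet x v) : y ∈ T.chainTo x :=
  hT.chainTo_trans (hT.meet_mem hx hv).1 (hT.mem_chainTo_of_le (hT.meet_mem hx hv).2 h hle)

theorem meet_father (_hT : T.IsIncreasingTree) (hx : x ∈ T.verts) (h : x ∉ T.chainTo v) :
    T.meet (T.father x) v = T.meet x v := by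
  rw [meet, meet, chainTo_eq_insert hx, insert_inter_of_notMem h]

/-- The root lies on every chain, so a vertex off some chain is not the root. -/
theorem father_mem (hT : T.IsIncreasingTree) (hx : x ∈ T.verts) (hv : v ∈ T.verts)
    (h : x ∉ T.chainTo v) : T.father x ∈ T.verts := by
  refine (hT.2.2.2 x hx fun h0 => h ?_).1
  obtain ⟨a, -, ha'⟩ := hT.exists_root
  have := ha' x hx
  rw [chainTo_eq_insert hx, h0, chainTo_eq_empty hT.zero_notMem, mem_insert] at this
  rcases this with rfl | h
  · exact ha' v hv
  · simp at h

/-- Below a vertex off the chain to `v`, the meet with `v` does not change. -/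
theorem meet_eq_of_mem (hT : T.IsIncreasingTree) (hv : v ∈ T.verts) (h : y ∈ T.chainTo x)
    (hy : y ∉ T.chainTo v) : T.meet x v = T.meet y v := by
  have hm := hT.meet_mem (chainTo_subset h) hv
  refine meet_eq (hT.chainTo_trans h hm.1) hm.2 fun z hz hzv => ?_
  refine le_meet (hT.mem_chainTo_of_le h hz ?_) hzv
  by_contra hlt
  exact hy (hT.chainTo_trans hzv (hT.mem_chainTo_of_le hz h (by omega)))

/-- Among three vertices two of the three meets agree. -/
theorem meet_cases (hT : T.IsIncreasingTree) (hx : x ∈ T.verts) (hv : v ∈ T.verts)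
    (hw : w ∈ T.verts) :
    T.meet x v = T.meet x w ∨ T.meet x v = T.meet v w ∨ T.meet x w = T.meet v w := by
  have h1 := hT.meet_mem hx hv
  have h2 := hT.meet_mem hx hw
  have h3 := hT.meet_mem hv hw
  rcases lt_trichotomy (T.meet x v) (T.meet x w) with h | h | h
  · right; left
    refine le_antisymm (le_meet h1.2 ?_) (le_meet ?_ h3.1)
    · exact hT.mem_chainTo_of_le_meet hw hx h1.1 (by rw [T.meet_comm w x]; exact h.le)
    · by_contra hn
      have : T.meet x w < T.meet v w := by
        by_contra hle
        exact hn (hT.mem_chainTo_of_le_meet hx hw h3.2 (by omega))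
      have := le_meet h2.1 (hT.mem_chainTo_of_le_meet hv hw h2.2 this.le)
      omega
  · exact Or.inl h
  · right; right
    refine le_antisymm (le_meet ?_ h2.2) (le_meet ?_ h3.2)
    · exact hT.mem_chainTo_of_le_meet hv hx h2.1 (by rw [T.meet_comm v x]; exact h.le)
    · by_contra hn
      have : T.meet x v < T.meet v w := by
        by_contra hle
        exact hn (hT.mem_chainTo_of_le_meet hx hv h3.1 (by omega))
      have := le_meet h1.1 (hT.mem_chainTo_of_le_meet hw hv h1.2 (by rw [T.meet_comm w v]; exact this.le))
      omega

end IsIncreasingTree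

/-! ### Splices -/

/-- The data needed to form the splice of two increasing trees. -/
structure Splicing (T₁ : LTree) (v₁ : ℕ) (T₂ : LTree) (v₂ : ℕ) : Prop where
  left : T₁.IsIncreasingTree
  right : T₂.IsIncreasingTree
  disj : Disjoint T₁.verts T₂.verts
  mem_left : v₁ ∈ T₁.verts
  mem_right : v₂ ∈ T₂.verts

namespace Splicing

theorem symm (h : Splicing T₁ v₁ T₂ v₂) : Splicing T₂ v₂ T₁ v₁ :=
  ⟨h.right, h.left, h.disj.symm, h.mem_right, h.mem_left⟩

/-- With disjoint vertex-sets the order of the cases in the father function is immaterial. This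
halves the work below. -/
theorem splice_comm (h : Splicing T₁ v₁ T₂ v₂) : T₁.splice v₁ T₂ v₂ = T₂.splice v₂ T₁ v₁ := by
  refine LTree.ext (union_comm _ _) (funext fun x => ?_)
  simp only [splice]
  rw [union_comm]
  split_ifs with h1 h2 h3 h3
  · rfl
  · exact absurd h3 (disjoint_left.1 h.disj h2)
  · rfl
  · rfl
  · rw [h.left.2.1 x h2, h.right.2.1 x h3]

theorem father_of_mem (hx : x ∈ T₁.chainTo v₁ ∪ T₂.chainTo v₂) :
    (T₁.splice v₁ T₂ v₂).father x = pred (T₁.chainTo v₁ ∪ T₂.chainTo v₂) x := if_pos hx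

theorem father_left (h : Splicing T₁ v₁ T₂ v₂) (hx : x ∈ T₁.verts) (hx' : x ∉ T₁.chainTo v₁) :
    (T₁.splice v₁ T₂ v₂).father x = T₁.father x := by
  have : x ∉ T₁.chainTo v₁ ∪ T₂.chainTo v₂ := by
    rw [mem_union]
    rintro (h' | h')
    · exact hx' h'
    · exact disjoint_left.1 h.disj hx (chainTo_subset h')
  simp only [splice, if_neg this, if_pos hx]

theorem father_right (h : Splicing T₁ v₁ T₂ v₂) (hx : x ∈ T₂.verts) (hx' : x ∉ T₂.chainTo v₂) :
    (T₁.splice v₁ T₂ v₂).father x = T₂.father x := by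
  rw [h.splice_comm, h.symm.father_left hx hx']

theorem isIncreasingTree (h : Splicing T₁ v₁ T₂ v₂) : (T₁.splice v₁ T₂ v₂).IsIncreasingTree := by
  set K := T₁.chainTo v₁ ∪ T₂.chainTo v₂ with hK
  have hKv : K ⊆ T₁.verts ∪ T₂.verts := union_subset_union chainTo_subset chainTo_subset
  have hpos : ∀ v ∈ T₁.verts ∪ T₂.verts, 0 < v := fun v hv => by
    rcases mem_union.1 hv with hv | hv
    · exact h.left.1 v hv
    · exact h.right.1 v hv
  have hne : K.Nonempty := ⟨v₁, mem_union_left _ (self_mem_chainTo h.mem_left)⟩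
  have hout : ∀ x ∈ T₁.verts ∪ T₂.verts, x ∉ K →
      (T₁.splice v₁ T₂ v₂).father x ∈ T₁.verts ∪ T₂.verts ∧
        (T₁.splice v₁ T₂ v₂).father x < x := by
    intro x hx hxK
    rw [hK, mem_union, not_or] at hxK
    rcases mem_union.1 hx with hx | hx
    · rw [h.father_left hx hxK.1]
      exact ⟨mem_union_left _ (h.left.father_mem hx h.mem_left hxK.1), h.left.father_lt hx⟩
    · rw [h.father_right hx hxK.2]
      exact ⟨mem_union_right _ (h.right.father_mem hx h.mem_right hxK.2), h.right.father_lt hx⟩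
  refine ⟨hpos, fun v hv => ?_, ⟨K.min' hne, ⟨hKv (K.min'_mem hne), ?_⟩, ?_⟩, fun v hv h0 => ?_⟩
  · have hv' : v ∉ T₁.verts ∪ T₂.verts := hv
    have hvK : v ∉ K := fun hh => hv' (hKv hh)
    rw [mem_union, not_or] at hv'
    simp only [splice, ← hK, if_neg hvK, if_neg hv'.1]
    exact h.right.2.1 v hv'.2
  · rw [father_of_mem (K.min'_mem hne)]
    exact pred_eq_zero fun y hy => K.min'_le y hy
  · rintro y ⟨hy, hy0⟩
    by_cases hyK : y ∈ K
    · rw [father_of_mem hyK] at hy0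
      rcases pred_spec K y with h' | h'
      · have := hpos _ (hKv h'.1)
        rw [← hK] at hy0
        omega
      · exact le_antisymm (h'.2 _ (K.min'_mem hne)) (K.min'_le y hyK)
    · have := hpos _ (hout y hy hyK).1
      omega
  · by_cases hvK : v ∈ K
    · rw [father_of_mem hvK] at h0 ⊢
      rcases pred_spec K v with h' | h'
      · exact ⟨hKv h'.1, h'.2⟩
      · exact absurd h'.1 h0
    · exact hout v hv hvK

theorem chainTo_of_mem (h : Splicing T₁ v₁ T₂ v₂) (hx : x ∈ T₁.chainTo v₁ ∪ T₂.chainTo v₂) :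
    (T₁.splice v₁ T₂ v₂).chainTo x = (T₁.chainTo v₁ ∪ T₂.chainTo v₂).filter (· ≤ x) := by
  have hT := h.isIncreasingTree
  set K := T₁.chainTo v₁ ∪ T₂.chainTo v₂ with hK
  have hKv : K ⊆ T₁.verts ∪ T₂.verts := union_subset_union chainTo_subset chainTo_subset
  induction x using Nat.strong_induction_on with
  | _ x ih =>
    rw [chainTo_eq_insert (hKv hx), father_of_mem hx, ← hK]
    rcases pred_spec K x with h' | h'
    · rw [ih _ h'.2 h'.1]
      ext y
      simp only [mem_insert, mem_filter]
      constructor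
      · rintro (rfl | ⟨h1, h2⟩)
        · exact ⟨hx, le_rfl⟩
        · exact ⟨h1, by omega⟩
      · rintro ⟨h1, h2⟩
        rcases h2.eq_or_lt with h3 | h3
        · exact Or.inl h3
        · exact Or.inr ⟨h1, le_pred h1 h3⟩
    · rw [h'.1, chainTo_eq_empty hT.zero_notMem]
      ext y
      simp only [mem_insert, mem_filter, notMem_empty, or_false]
      constructor
      · rintro rfl; exact ⟨hx, le_rfl⟩
      · rintro ⟨h1, h2⟩; exact le_antisymm h2 (h'.2 y h1)

/-- The chain to `x` follows the merged chain up to the vertex where it leaves the chain to `v₁`;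
only the vertices of the other chain below that point are interleaved. -/
theorem chainTo_left (h : Splicing T₁ v₁ T₂ v₂) (hx : x ∈ T₁.verts) :
    (T₁.splice v₁ T₂ v₂).chainTo x =
      T₁.chainTo x ∪ (T₂.chainTo v₂).filter (· < T₁.meet x v₁) := by
  have hT := h.isIncreasingTree
  induction x using Nat.strong_induction_on with
  | _ x ih =>
    by_cases hxK : x ∈ T₁.chainTo v₁
    · rw [h.chainTo_of_mem (mem_union_left _ hxK), h.left.meet_of_mem hxK,
        h.left.chainTo_of_mem hxK]
      ext y
      simp only [mem_filter, mem_union]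
      constructor
      · rintro ⟨h1 | h1, h2⟩
        · exact Or.inl ⟨h1, h2⟩
        · refine Or.inr ⟨h1, lt_of_le_of_ne h2 ?_⟩
          rintro rfl
          exact disjoint_left.1 h.disj hx (chainTo_subset h1)
      · rintro (⟨h1, h2⟩ | ⟨h1, h2⟩)
        · exact ⟨Or.inl h1, h2⟩
        · exact ⟨Or.inr h1, h2.le⟩
    · rw [chainTo_eq_insert (mem_union_left _ hx), h.father_left hx hxK,
        ih _ (h.left.father_lt hx) (h.left.father_mem hx h.mem_left hxK),
        h.left.meet_father hx hxK, chainTo_eq_insert hx, insert_union]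

theorem chainTo_right (h : Splicing T₁ v₁ T₂ v₂) (hx : x ∈ T₂.verts) :
    (T₁.splice v₁ T₂ v₂).chainTo x =
      T₂.chainTo x ∪ (T₁.chainTo v₁).filter (· < T₂.meet x v₂) := by
  rw [h.splice_comm, h.symm.chainTo_left hx]

/-- Splicing only inserts foreign vertices into a chain, so `T₁` can be recovered from the splice
once its vertex-set is known. -/
theorem chainTo_inter_left (h : Splicing T₁ v₁ T₂ v₂) (hx : x ∈ T₁.verts) :
    (T₁.splice v₁ T₂ v₂).chainTo x ∩ T₁.verts = T₁.chainTo x := by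
  rw [h.chainTo_left hx]
  ext y
  simp only [mem_inter, mem_union, mem_filter]
  constructor
  · rintro ⟨h1 | h1, h2⟩
    · exact h1
    · exact absurd (chainTo_subset h1.1) (disjoint_left.1 h.disj h2)
  · exact fun h1 => ⟨Or.inl h1, chainTo_subset h1⟩

theorem chainTo_inter_right (h : Splicing T₁ v₁ T₂ v₂) (hx : x ∈ T₂.verts) :
    (T₁.splice v₁ T₂ v₂).chainTo x ∩ T₂.verts = T₂.chainTo x := by
  rw [h.splice_comm, h.symm.chainTo_inter_left hx]

theorem chainTo_top (h : Splicing T₁ v₁ T₂ v₂) (hlt : v₂ < v₁) :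
    (T₁.splice v₁ T₂ v₂).chainTo v₁ = T₁.chainTo v₁ ∪ T₂.chainTo v₂ := by
  rw [h.chainTo_of_mem (mem_union_left _ (self_mem_chainTo h.mem_left))]
  refine filter_true_of_mem fun y hy => ?_
  rcases mem_union.1 hy with hy | hy
  · exact h.left.le_of_mem_chainTo hy
  · exact (h.right.le_of_mem_chainTo hy).trans hlt.le

theorem meet_left (h : Splicing T₁ v₁ T₂ v₂) (hlt : v₂ < v₁) (hx : x ∈ T₁.verts) :
    (T₁.splice v₁ T₂ v₂).meet x v₁ = T₁.meet x v₁ := by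
  have hm := h.left.meet_mem hx h.mem_left
  apply meet_eq
  · rw [h.chainTo_left hx]; exact mem_union_left _ hm.1
  · rw [h.chainTo_top hlt]; exact mem_union_left _ hm.2
  · intro z hz hz'
    rw [h.chainTo_left hx] at hz
    rw [h.chainTo_top hlt] at hz'
    rcases mem_union.1 hz with hz | hz
    · rcases mem_union.1 hz' with hz' | hz'
      · exact le_meet hz hz'
      · exact absurd (chainTo_subset hz') (disjoint_left.1 h.disj (chainTo_subset hz))
    · exact (mem_filter.1 hz).2.le

theorem meet_right (h : Splicing T₁ v₁ T₂ v₂) (hlt : v₂ < v₁) (hx : x ∈ T₂.verts) :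
    (T₁.splice v₁ T₂ v₂).meet x v₁ = T₂.meet x v₂ := by
  have hm := h.right.meet_mem hx h.mem_right
  apply meet_eq
  · rw [h.chainTo_right hx]; exact mem_union_left _ hm.1
  · rw [h.chainTo_top hlt]; exact mem_union_right _ hm.2
  · intro z hz hz'
    rw [h.chainTo_right hx] at hz
    rw [h.chainTo_top hlt] at hz'
    rcases mem_union.1 hz with hz | hz
    · rcases mem_union.1 hz' with hz' | hz'
      · exact absurd (chainTo_subset hz) (disjoint_left.1 h.disj (chainTo_subset hz'))
      · exact le_meet hz hz'
    · exact (mem_filter.1 hz).2.le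

theorem meet_right_right (h : Splicing T₁ v₁ T₂ v₂) (hx : x ∈ T₂.verts) (hw : w ∈ T₂.verts) :
    (T₁.splice v₁ T₂ v₂).meet x w = T₂.meet x w := by
  have hm := h.right.meet_mem hx hw
  have hx2 := h.right.meet_mem hx h.mem_right
  have hw2 := h.right.meet_mem hw h.mem_right
  apply meet_eq
  · rw [h.chainTo_right hx]; exact mem_union_left _ hm.1
  · rw [h.chainTo_right hw]; exact mem_union_left _ hm.2
  · intro z hz hz'
    rw [h.chainTo_right hx] at hz
    rw [h.chainTo_right hw] at hz'
    rcases mem_union.1 hz with hz | hz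
    · rcases mem_union.1 hz' with hz' | hz'
      · exact le_meet hz hz'
      · exact absurd (chainTo_subset hz)
          (disjoint_left.1 h.disj (chainTo_subset (mem_filter.1 hz').1))
    · rcases mem_union.1 hz' with hz' | hz'
      · exact absurd (chainTo_subset hz')
          (disjoint_left.1 h.disj (chainTo_subset (mem_filter.1 hz).1))
      -- A common vertex from `T₁` lies below both exits from the chain to `v₂`. The smaller exit
      -- belongs to both chains, so it is at most the meet in `T₂`.
      · have e1 := (mem_filter.1 hz).2
        have e2 := (mem_filter.1 hz').2
        rcases le_total (T₂.meet x v₂) (T₂.meet w v₂) with hle | hle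
        · have := le_meet hx2.1 (h.right.mem_chainTo_of_le_meet hw h.mem_right hx2.2 hle)
          omega
        · have := le_meet (h.right.mem_chainTo_of_le_meet hx h.mem_right hw2.2 hle) hw2.1
          omega

theorem meet_left_right (h : Splicing T₁ v₁ T₂ v₂) (hx : x ∈ T₁.verts) (hw : w ∈ T₂.verts) :
    (T₁.splice v₁ T₂ v₂).meet x w = min (T₁.meet x v₁) (T₂.meet w v₂) := by
  have hx1 := h.left.meet_mem hx h.mem_left
  have hw2 := h.right.meet_mem hw h.mem_right
  have hne : T₁.meet x v₁ ≠ T₂.meet w v₂ := fun e =>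
    disjoint_left.1 h.disj (chainTo_subset hx1.1) (e ▸ chainTo_subset hw2.1)
  apply meet_eq
  · rw [h.chainTo_left hx]
    rcases lt_or_gt_of_ne hne with hlt | hlt
    · rw [min_eq_left hlt.le]; exact mem_union_left _ hx1.1
    · rw [min_eq_right hlt.le]
      exact mem_union_right _ (mem_filter.2 ⟨hw2.2, hlt⟩)
  · rw [h.chainTo_right hw]
    rcases lt_or_gt_of_ne hne with hlt | hlt
    · rw [min_eq_left hlt.le]
      exact mem_union_right _ (mem_filter.2 ⟨hx1.2, hlt⟩)
    · rw [min_eq_right hlt.le]; exact mem_union_left _ hw2.1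
  · intro z hz hz'
    rw [h.chainTo_left hx] at hz
    rw [h.chainTo_right hw] at hz'
    rw [le_min_iff]
    rcases mem_union.1 hz with hz | hz <;> rcases mem_union.1 hz' with hz' | hz'
    · exact absurd (chainTo_subset hz') (disjoint_left.1 h.disj (chainTo_subset hz))
    · exact ⟨le_meet hz (mem_filter.1 hz').1, (mem_filter.1 hz').2.le⟩
    · exact ⟨(mem_filter.1 hz).2.le, le_meet hz' (mem_filter.1 hz).1⟩
    · exact absurd (chainTo_subset (mem_filter.1 hz).1)
        (disjoint_left.1 h.disj (chainTo_subset (mem_filter.1 hz').1))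

end Splicing

end LTree

/-! ### Orbits of a self-map that end at a fixed point -/

/-- Some iterate of `G` maps `x` to `v`. -/
def Reaches (G : ℕ → ℕ) (x v : ℕ) : Prop := ∃ n, G^[n] x = v

namespace Reaches

variable {G G' : ℕ → ℕ} {x v : ℕ}

theorem step_iff (hv : G v = v) : Reaches G (G x) v ↔ Reaches G x v := by
  constructor
  · rintro ⟨n, hn⟩
    exact ⟨n + 1, hn⟩
  · rintro ⟨n, hn⟩
    refine ⟨n, ?_⟩
    rw [← Function.iterate_succ_apply, Function.iterate_succ_apply', hn, hv]

theorem eq_of_fixed (hx : G x = x) (h : Reaches G x v) : x = v := by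
  obtain ⟨n, hn⟩ := h
  rwa [Function.iterate_fixed hx] at hn

/-- After `m * n ≥ n` iterations the orbit is back at `x`, yet it has stayed at `v` since time `n`.
-/
theorem eq_of_periodic {m : ℕ} (hm : 0 < m) (hx : G^[m] x = x) (hv : G v = v)
    (h : Reaches G x v) : x = v := by
  obtain ⟨n, hn⟩ := h
  have h1 : G^[m * n] x = x := by rw [Function.iterate_mul, Function.iterate_fixed hx]
  have h2 : n ≤ m * n := Nat.le_mul_of_pos_left n hm
  rw [← Nat.sub_add_cancel h2, Function.iterate_add_apply, hn, Function.iterate_fixed hv] at h1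
  exact h1.symm

theorem iterate_mem {S : Set ℕ} (hS : ∀ y ∈ S, G y ∈ S) (hx : x ∈ S) (n : ℕ) : G^[n] x ∈ S := by
  induction n with
  | zero => exact hx
  | succ n ih => rw [Function.iterate_succ_apply']; exact hS _ ih

theorem congr {S : Set ℕ} (hS : ∀ y ∈ S, G y ∈ S) (h : ∀ y ∈ S, G y = G' y) (hx : x ∈ S) :
    Reaches G x v ↔ Reaches G' x v := by
  have : ∀ n, G^[n] x = G'^[n] x := by
    intro n
    induction n with
    | zero => rfl
    | succ n ih =>
      rw [Function.iterate_succ_apply', Function.iterate_succ_apply', ← ih,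
        h _ (iterate_mem hS hx n)]
  simp only [Reaches, this]

end Reaches

/-! ### Link classes: recognising the first tree of a splice -/

namespace LTree

variable {top : ℕ → ℕ} {T T₁ T₂ : LTree} {v v₁ v₂ w x y : ℕ}

/-- Every block, given by the function `top` mapping its elements to its maximum, that meets `T`
is a subchain of `T`. -/
def Compat (top : ℕ → ℕ) (T : LTree) : Prop :=
  ∀ x ∈ T.verts, top x ∈ T.verts ∧ x ∈ T.chainTo (top x)

/-- The maximum of the block containing the vertex at which the chain to `x` leaves the chain
to `v`. -/
noncomputable def link (top : ℕ → ℕ) (T : LTree) (v x : ℕ) : ℕ := top (T.meet x v)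

/-- When the edges of the chain to `v` are cut, the components are kept together by the blocks. -/
def Linked (top : ℕ → ℕ) (T : LTree) (v : ℕ) : Prop :=
  ∀ x ∈ T.verts, Reaches (link top T v) (top x) v

open Classical in
/-- The vertices kept together with `v` by the blocks when the edges of the chain to `v` are
cut. -/
noncomputable def linkClass (top : ℕ → ℕ) (T : LTree) (v : ℕ) : Finset ℕ :=
  T.verts.filter fun x => Reaches (link top T v) (top x) v

theorem mem_linkClass :
    x ∈ linkClass top T v ↔ x ∈ T.verts ∧ Reaches (link top T v) (top x) v := by
  simp [linkClass]

theorem IsIncreasingTree.link_mem (hT : T.IsIncreasingTree) (hc : Compat top T) (hv : v ∈ T.verts)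
    (hx : x ∈ T.verts) : link top T v x ∈ T.verts :=
  (hc _ (chainTo_subset (hT.meet_mem hx hv).1)).1

theorem IsIncreasingTree.link_self (hT : T.IsIncreasingTree) (hv : v ∈ T.verts) (ht : top v = v) :
    link top T v v = v := by
  rw [link, hT.meet_of_mem (self_mem_chainTo hv), ht]

namespace Splicing

variable (h : Splicing T₁ v₁ T₂ v₂) (hlt : v₂ < v₁) (hc₁ : Compat top T₁) (hc₂ : Compat top T₂)
include h

theorem chainTo_subset_left (hx : x ∈ T₁.verts) :
    T₁.chainTo x ⊆ (T₁.splice v₁ T₂ v₂).chainTo x := by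
  rw [h.chainTo_left hx]
  exact subset_union_left

theorem chainTo_subset_right (hx : x ∈ T₂.verts) :
    T₂.chainTo x ⊆ (T₁.splice v₁ T₂ v₂).chainTo x := by
  rw [h.chainTo_right hx]
  exact subset_union_left

include hc₁ hc₂

theorem compat : Compat top (T₁.splice v₁ T₂ v₂) := by
  intro x hx
  rcases mem_union.1 hx with hx | hx
  · exact ⟨mem_union_left _ (hc₁ x hx).1, h.chainTo_subset_left (hc₁ x hx).1 (hc₁ x hx).2⟩
  · exact ⟨mem_union_right _ (hc₂ x hx).1, h.chainTo_subset_right (hc₂ x hx).1 (hc₂ x hx).2⟩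

include hlt

/-- Both vertex-sets are stable under the link map of the splice. On `T₁` it is the link map of
`T₁`, which leads to `v₁` by linkedness; an orbit starting in `T₂` never meets `v₁`. -/
theorem linkClass_eq (hl : Linked top T₁ v₁) :
    linkClass top (T₁.splice v₁ T₂ v₂) v₁ = T₁.verts := by
  ext x
  rw [mem_linkClass]
  have e1 : ∀ y ∈ (T₁.verts : Set ℕ),
      link top (T₁.splice v₁ T₂ v₂) v₁ y = link top T₁ v₁ y := fun y hy => by
    rw [link, link, h.meet_left hlt hy]
  have e2 : ∀ y ∈ (T₂.verts : Set ℕ), link top (T₁.splice v₁ T₂ v₂) v₁ y ∈ (T₂.verts : Set ℕ) :=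
    fun y hy => by
      rw [link, h.meet_right hlt hy]
      exact h.right.link_mem hc₂ h.mem_right hy
  constructor
  · rintro ⟨hx, n, hn⟩
    rcases mem_union.1 hx with hx | hx
    · exact hx
    · have := Reaches.iterate_mem e2 (hc₂ x hx).1 n
      rw [hn] at this
      exact absurd this (disjoint_left.1 h.disj h.mem_left)
  · intro hx
    refine ⟨mem_union_left _ hx, ?_⟩
    rw [Reaches.congr (S := (T₁.verts : Set ℕ)) _ e1 (hc₁ x hx).1]
    · exact hl x hx
    · intro y hy
      rw [e1 y hy]
      exact h.left.link_mem hc₁ h.mem_left hy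

/-- On `T₂` the link map towards `w` is unchanged. From a vertex of `T₁` it either makes a link step
of `T₁` towards `v₁` or passes to the block of the vertex at which the chains to `w` and `v₂`
separate, which is a vertex of `T₂`. At `v₁` the latter is forced, since `v₁ > v₂`. -/
theorem linked_iff (hl : Linked top T₁ v₁) (hw : w ∈ T₂.verts) :
    Linked top (T₁.splice v₁ T₂ v₂) w ↔ Linked top T₂ w := by
  set T := T₁.splice v₁ T₂ v₂ with hT
  have e2 : ∀ y ∈ (T₂.verts : Set ℕ), link top T w y = link top T₂ w y := fun y hy => by
    rw [link, link, h.meet_right_right hy hw]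
  have c2 : ∀ x ∈ T₂.verts, Reaches (link top T w) (top x) w ↔
      Reaches (link top T₂ w) (top x) w := fun x hx => by
    refine Reaches.congr (fun y hy => ?_) e2 (hc₂ x hx).1
    rw [e2 y hy]
    exact h.right.link_mem hc₂ hw hy
  constructor
  · exact fun hL x hx => (c2 x hx).1 (hL x (mem_union_right _ hx))
  · intro hL
    have hm2 := h.right.meet_mem hw h.mem_right
    have hexit := (c2 _ (chainTo_subset hm2.1)).2 (hL _ (chainTo_subset hm2.1))
    -- Induction on the number of link steps of `T₁` that separate `z` from `v₁`.
    have key : ∀ n, ∀ z ∈ T₁.verts, (link top T₁ v₁)^[n] z = v₁ → Reaches (link top T w) z w := by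
      intro n
      induction n with
      | zero =>
        rintro z hz hzv
        have hzv : z = v₁ := hzv
        subst hzv
        obtain ⟨n, hn⟩ := hexit
        refine ⟨n + 1, ?_⟩
        rw [Function.iterate_succ_apply, link, h.meet_left_right hz hw,
          h.left.meet_of_mem (self_mem_chainTo hz), min_eq_right]
        · exact hn
        · exact (h.right.le_of_mem_chainTo hm2.2).trans hlt.le
      | succ n ih =>
        intro z hz hzv
        rw [Function.iterate_succ_apply] at hzv
        have hR : Reaches (link top T w) (link top T w z) w := by
          rw [show link top T w z = top (T.meet z w) from rfl, h.meet_left_right hz hw]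
          rcases le_total (T₁.meet z v₁) (T₂.meet w v₂) with hle | hle
          · rw [min_eq_left hle]
            exact ih _ (h.left.link_mem hc₁ h.mem_left hz) hzv
          · rwa [min_eq_right hle]
        obtain ⟨n, hn⟩ := hR
        exact ⟨n + 1, hn⟩
    intro x hx
    rcases mem_union.1 hx with hx | hx
    · obtain ⟨n, hn⟩ := hl x hx
      exact key n _ (hc₁ x hx).1 hn
    · exact (c2 x hx).2 (hL x hx)

end Splicing

/-- A tree determines the two trees whose splice it is, provided that the first one is linked. -/
theorem Splicing.unique {T₁' T₂' : LTree} {v₂' : ℕ} (h : Splicing T₁ v₁ T₂ v₂)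
    (h' : Splicing T₁' v₁ T₂' v₂') (hlt : v₂ < v₁) (hlt' : v₂' < v₁)
    (hc₁ : Compat top T₁) (hc₂ : Compat top T₂) (hc₁' : Compat top T₁') (hc₂' : Compat top T₂')
    (hl : Linked top T₁ v₁) (hl' : Linked top T₁' v₁)
    (e : T₁.splice v₁ T₂ v₂ = T₁'.splice v₁ T₂' v₂') : T₁ = T₁' ∧ T₂ = T₂' ∧ v₂ = v₂' := by
  have hV₁ : T₁.verts = T₁'.verts := by
    rw [← h.linkClass_eq hlt hc₁ hc₂ hl, ← h'.linkClass_eq hlt' hc₁' hc₂' hl', e]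
  have hV : T₁.verts ∪ T₂.verts = T₁'.verts ∪ T₂'.verts := congrArg LTree.verts e
  have hV₂ : T₂.verts = T₂'.verts := by
    rw [← union_sdiff_cancel_left h.disj, hV, hV₁, union_sdiff_cancel_left h'.disj]
  refine ⟨h.left.ext_chainTo h'.left hV₁ fun x hx => ?_,
    h.right.ext_chainTo h'.right hV₂ fun x hx => ?_, ?_⟩
  · rw [← h.chainTo_inter_left hx, ← h'.chainTo_inter_left (hV₁ ▸ hx), e, hV₁]
  · rw [← h.chainTo_inter_right hx, ← h'.chainTo_inter_right (hV₂ ▸ hx), e, hV₂]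
  -- The splicing vertex is the largest vertex of `T₂` on the chain to `v₁`.
  · have aux : ∀ {T₁ T₂ : LTree} {v₂ : ℕ}, Splicing T₁ v₁ T₂ v₂ → v₂ < v₁ →
        ((T₁.splice v₁ T₂ v₂).chainTo v₁ ∩ T₂.verts).sup id = v₂ := by
      intro T₁ T₂ v₂ h hlt
      rw [h.chainTo_top hlt]
      apply le_antisymm
      · refine Finset.sup_le fun z hz => ?_
        obtain ⟨hz, hz2⟩ := mem_inter.1 hz
        rcases mem_union.1 hz with hz | hz
        · exact absurd hz2 (disjoint_left.1 h.disj (chainTo_subset hz))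
        · exact h.right.le_of_mem_chainTo hz
      · exact Finset.le_sup (f := id)
          (mem_inter.2 ⟨mem_union_right _ (self_mem_chainTo h.mem_right), h.mem_right⟩)
    rw [← aux h hlt, ← aux h' hlt', e, hV₂]

/-- Otherwise `w` is led to `v` by the link map towards `v`, and `v` to `w` by the one towards `w`.
Both orbits start with the same step, to `P`. They can only diverge at a vertex where one of the
maps returns to `P`, making `P` periodic although its orbit ends at another fixed point. So they
agree forever; but then the orbit towards `v` passes through `w` and returns to `P`, which is again
impossible. -/
theorem IsIncreasingTree.notMem_linkClass (hT : T.IsIncreasingTree) (hc : Compat top T)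
    (hl : Linked top T w) (hv : v ∈ T.verts) (hw : w ∈ T.verts) (htv : top v = v) (htw : top w = w)
    (hne : v ≠ w) : w ∉ linkClass top T v := by
  rw [mem_linkClass, htw]
  rintro ⟨-, hR⟩
  set P := top (T.meet v w) with hP
  have hPT : P ∈ T.verts := (hc _ (chainTo_subset (hT.meet_mem hv hw).1)).1
  have hvv := hT.link_self hv htv
  have hww := hT.link_self hw htw
  have hvw : link top T v w = P := by rw [link, T.meet_comm w v]
  have hwv : link top T w v = P := rfl
  have hL : Reaches (link top T w) v w := by simpa [htv] using hl v hv
  have hPv : P ≠ v := fun e => hne (Reaches.eq_of_fixed (hwv.trans e) hL)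
  have hPw : P ≠ w := fun e => hne (Reaches.eq_of_fixed (hvw.trans e) hR).symm
  have hRv : Reaches (link top T v) P v := by rw [← hvw]; exact (Reaches.step_iff hvv).2 hR
  have hRw : Reaches (link top T w) P w := by rw [← hwv]; exact (Reaches.step_iff hww).2 hL
  have agree : ∀ i, (link top T v)^[i] P = (link top T w)^[i] P := by
    intro i
    induction i with
    | zero => rfl
    | succ i ih =>
      have hz : (link top T w)^[i] P ∈ (T.verts : Set ℕ) :=
        Reaches.iterate_mem (fun y hy => hT.link_mem hc hw hy) hPT i
      -- If the meets with `v` and `w` agree, so do the two steps. In the other cases one meet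
      -- equals that of `v` and `w`, and the step leads back to `P`.
      rcases hT.meet_cases hz hv hw with h | h | h
      · rw [Function.iterate_succ_apply', Function.iterate_succ_apply', ih, link, link, h]
      · refine absurd (Reaches.eq_of_periodic (Nat.succ_pos i) ?_ hvv hRv) hPv
        rw [Function.iterate_succ_apply', ih, link, h]
      · refine absurd (Reaches.eq_of_periodic (Nat.succ_pos i) ?_ hww hRw) hPw
        rw [Function.iterate_succ_apply', link, h]
  obtain ⟨n, hn⟩ := hRw
  refine hPv (Reaches.eq_of_periodic (Nat.succ_pos n) ?_ hvv hRv)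
  rw [Function.iterate_succ_apply', agree n, hn, hvw]

/-- A minimal vertex that is the maximum of its own block is a fixed point of the link map. This
serves for the component of index `1`, whose root is the singleton block. -/
theorem IsIncreasingTree.root_notMem_linkClass (hT : T.IsIncreasingTree) (hx : x ∈ T.verts)
    (hv : v ∈ T.verts) (ht : top x = x) (hmin : ∀ y ∈ T.verts, x ≤ y) (hne : x ≠ v) :
    x ∉ linkClass top T v := by
  rw [mem_linkClass, ht]
  rintro ⟨-, hR⟩
  refine hne (Reaches.eq_of_fixed ?_ hR)
  have hm := hT.meet_mem hx hv
  rw [link, le_antisymm (hT.le_of_mem_chainTo hm.1) (hmin _ (chainTo_subset hm.1)), ht]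

/-! ### Restrictions -/

/-- The tree induced on a set `V` of vertices of `T`. -/
noncomputable def restrict (T : LTree) (V : Finset ℕ) : LTree where
  verts := V
  father x := if x ∈ V then pred (T.chainTo x ∩ V) x else 0

section restrict

variable {V : Finset ℕ} (hT : T.IsIncreasingTree) (hV : V ⊆ T.verts) (hv : v ∈ T.verts)
  (hne : V.Nonempty) (hm : ∀ x ∈ V, T.meet x v ∈ V)
include hT hV hv hne hm

/-- Closure of `V` under meets with `v` forces a single root: a vertex of `V` without ancestors in
`V` equals its meet with `v`, so it is the smallest vertex of `V` on the chain to `v`. -/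
theorem IsIncreasingTree.restrict : (T.restrict V).IsIncreasingTree := by
  have hf : ∀ x ∈ V, (T.restrict V).father x = pred (T.chainTo x ∩ V) x := fun x hx => if_pos hx
  have hK : (T.chainTo v ∩ V).Nonempty := by
    obtain ⟨x, hx⟩ := hne
    exact ⟨_, mem_inter.2 ⟨(hT.meet_mem (hV hx) hv).2, hm x hx⟩⟩
  have hroot := mem_inter.1 ((T.chainTo v ∩ V).min'_mem hK)
  refine ⟨fun x hx => hT.1 x (hV hx), fun x hx => if_neg hx,
    ⟨(T.chainTo v ∩ V).min' hK, ⟨hroot.2, ?_⟩, ?_⟩, fun x hx h0 => ?_⟩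
  · rw [hf _ hroot.2]
    refine pred_eq_zero fun y hy => min'_le _ _ ?_
    exact mem_inter.2 ⟨hT.chainTo_trans hroot.1 (mem_inter.1 hy).1, (mem_inter.1 hy).2⟩
  · rintro x ⟨hx, h0⟩
    have hx : x ∈ V := hx
    rw [hf x hx] at h0
    rcases pred_spec (T.chainTo x ∩ V) x with h' | h'
    · have := hT.1 _ (hV (mem_inter.1 h'.1).2)
      omega
    · have hmx := hT.meet_mem (hV hx) hv
      have e : T.meet x v = x := le_antisymm (hT.le_of_mem_chainTo hmx.1)
        (h'.2 _ (mem_inter.2 ⟨hmx.1, hm x hx⟩))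
      rw [e] at hmx
      refine le_antisymm (h'.2 _ (mem_inter.2 ⟨?_, hroot.2⟩)) (min'_le _ _ ?_)
      · exact hT.mem_chainTo_of_le hmx.2 hroot.1 (min'_le _ _ (mem_inter.2 ⟨hmx.2, hx⟩))
      · exact mem_inter.2 ⟨hmx.2, hx⟩
  · have hx : x ∈ V := hx
    rw [hf x hx] at h0 ⊢
    rcases pred_spec (T.chainTo x ∩ V) x with h' | h'
    · exact ⟨(mem_inter.1 h'.1).2, h'.2⟩
    · exact absurd h'.1 h0

theorem restrict_chainTo (hx : x ∈ V) : (T.restrict V).chainTo x = T.chainTo x ∩ V := by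
  have hR := hT.restrict hV hv hne hm
  induction x using Nat.strong_induction_on with
  | _ x ih =>
    rw [chainTo_eq_insert hx, show (T.restrict V).father x = pred (T.chainTo x ∩ V) x from
      if_pos hx]
    have hxx := mem_inter.2 ⟨self_mem_chainTo (hV hx), hx⟩
    rcases pred_spec (T.chainTo x ∩ V) x with h' | h'
    · have hp := mem_inter.1 h'.1
      rw [ih _ h'.2 hp.2, hT.chainTo_of_mem hp.1]
      ext y
      simp only [mem_insert, mem_inter, mem_filter]
      constructor
      · rintro (rfl | ⟨⟨h1, -⟩, h2⟩)
        · exact mem_inter.1 hxx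
        · exact ⟨h1, h2⟩
      · rintro ⟨h1, h2⟩
        rcases (hT.le_of_mem_chainTo h1).eq_or_lt with h3 | h3
        · exact Or.inl h3
        · exact Or.inr ⟨⟨h1, le_pred (mem_inter.2 ⟨h1, h2⟩) h3⟩, h2⟩
    · rw [h'.1, chainTo_eq_empty hR.zero_notMem]
      ext y
      rw [mem_insert]
      constructor
      · rintro (rfl | h)
        · exact hxx
        · simp at h
      · intro h
        exact Or.inl (le_antisymm (hT.le_of_mem_chainTo (mem_inter.1 h).1) (h'.2 y h))

-- With `hm` and `hm'`, `V` is a union of components left by cutting the chain to `v`, and off that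
-- chain the father lies in the same component.
omit hne in
theorem restrict_father (hx : x ∈ V) (hxv : x ∉ T.chainTo v)
    (hm' : ∀ x ∈ T.verts, T.meet x v ∈ V → x ∈ V) : (T.restrict V).father x = T.father x := by
  have hf := hT.father_mem (hV hx) hv hxv
  rw [show (T.restrict V).father x = pred (T.chainTo x ∩ V) x from if_pos hx]
  refine pred_eq (mem_inter.2 ⟨?_, ?_⟩) (hT.father_lt (hV hx)) fun z hz hzx => ?_
  · rw [chainTo_eq_insert (hV hx)]
    exact mem_insert_of_mem (self_mem_chainTo hf)
  · apply hm' _ hf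
    rw [hT.meet_father (hV hx) hxv]
    exact hm x hx
  · have := (mem_inter.1 hz).1
    rw [chainTo_eq_insert (hV hx), mem_insert] at this
    rcases this with rfl | h
    · omega
    · exact hT.le_of_mem_chainTo h

theorem restrict_compat (hc : Compat top T) (ht : ∀ x ∈ V, top x ∈ V) :
    Compat top (T.restrict V) := by
  intro x hx
  refine ⟨ht x hx, ?_⟩
  rw [restrict_chainTo hT hV hv hne hm (ht x hx)]
  exact mem_inter.2 ⟨(hc x (hV hx)).2, hx⟩

theorem restrict_meet (hx : x ∈ V) (hvV : v ∈ V) : (T.restrict V).meet x v = T.meet x v := by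
  have hmx := hT.meet_mem (hV hx) hv
  apply meet_eq
  · rw [restrict_chainTo hT hV hv hne hm hx]
    exact mem_inter.2 ⟨hmx.1, hm x hx⟩
  · rw [restrict_chainTo hT hV hv hne hm hvV]
    exact mem_inter.2 ⟨hmx.2, hm x hx⟩
  · intro z hz hz'
    rw [restrict_chainTo hT hV hv hne hm hx] at hz
    rw [restrict_chainTo hT hV hv hne hm hvV] at hz'
    exact le_meet (mem_inter.1 hz).1 (mem_inter.1 hz').1

end restrict

/-- The class is a union of components of the cut tree. If `x` is off the chain to `v`, so is the
maximum of its block further up, and both leave the chain at the same vertex; one link step then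
relates the two conditions. -/
theorem IsIncreasingTree.meet_mem_linkClass (hT : T.IsIncreasingTree) (hc : Compat top T)
    (hv : v ∈ T.verts) (ht : top v = v) (hx : x ∈ T.verts) :
    T.meet x v ∈ linkClass top T v ↔ x ∈ linkClass top T v := by
  by_cases hxv : x ∈ T.chainTo v
  · rw [hT.meet_of_mem hxv]
  · rw [mem_linkClass, mem_linkClass, ← hT.meet_eq_of_mem hv (hc x hx).2 hxv,
      show top (T.meet (top x) v) = link top T v (top x) from rfl,
      Reaches.step_iff (hT.link_self hv ht)]
    exact and_congr_left fun _ => iff_of_true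
      (chainTo_subset (hT.meet_mem (hc x hx).1 hv).1) hx

/-- Every tree that is not linked is a splice whose first tree is. -/
theorem IsIncreasingTree.exists_splice (hT : T.IsIncreasingTree) (hc : Compat top T)
    (htop : ∀ x, top (top x) = top x) (hv : v ∈ T.verts) (ht : top v = v)
    (hne : (T.verts \ linkClass top T v).Nonempty) :
    ∃ T₁ T₂ v₂, Splicing T₁ v T₂ v₂ ∧ v₂ < v ∧ Compat top T₁ ∧ Compat top T₂ ∧
      Linked top T₁ v ∧ T₁.verts = linkClass top T v ∧ T₂.verts = T.verts \ linkClass top T v ∧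
      T = T₁.splice v T₂ v₂ := by
  set V := linkClass top T v with hVdef
  have hV : V ⊆ T.verts := fun x hx => (mem_linkClass.1 hx).1
  have hW : T.verts \ V ⊆ T.verts := sdiff_subset
  have hmV : ∀ x ∈ T.verts, (T.meet x v ∈ V ↔ x ∈ V) := fun x hx =>
    hT.meet_mem_linkClass hc hv ht hx
  have hvV : v ∈ V := mem_linkClass.2 ⟨hv, 0, ht⟩
  have hmV1 : ∀ x ∈ V, T.meet x v ∈ V := fun x hx => (hmV x (hV hx)).2 hx
  have hmW1 : ∀ x ∈ T.verts \ V, T.meet x v ∈ T.verts \ V := fun x hx => by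
    rw [mem_sdiff] at hx ⊢
    exact ⟨chainTo_subset (hT.meet_mem hx.1 hv).1, fun h => hx.2 ((hmV x hx.1).1 h)⟩
  have hmW2 : ∀ x ∈ T.verts, T.meet x v ∈ T.verts \ V → x ∈ T.verts \ V := fun x hx h => by
    rw [mem_sdiff] at h ⊢
    exact ⟨hx, fun h' => h.2 ((hmV x hx).2 h')⟩
  have htV : ∀ x ∈ T.verts, (top x ∈ V ↔ x ∈ V) := fun x hx => by
    rw [hVdef, mem_linkClass, mem_linkClass, htop]
    exact and_congr_left fun _ => iff_of_true (hc x hx).1 hx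
  have hK : (T.chainTo v ∩ (T.verts \ V)).Nonempty := by
    obtain ⟨x, hx⟩ := hne
    exact ⟨_, mem_inter.2 ⟨(hT.meet_mem (hW hx) hv).2, hmW1 x hx⟩⟩
  -- The second splicing vertex has to be the last vertex of the chain to `v` outside the class; the
  -- two restricted chains then make up the whole chain to `v`.
  set v₂ := (T.chainTo v ∩ (T.verts \ V)).max' hK with hv₂
  have hv₂m := mem_inter.1 ((T.chainTo v ∩ (T.verts \ V)).max'_mem hK)
  rw [← hv₂] at hv₂m
  have hne1 : V.Nonempty := ⟨v, hvV⟩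
  have hS : Splicing (T.restrict V) v (T.restrict (T.verts \ V)) v₂ :=
    ⟨hT.restrict hV hv hne1 hmV1, hT.restrict hW hv hne hmW1, disjoint_sdiff, hvV, hv₂m.2⟩
  have hlt : v₂ < v := lt_of_le_of_ne (hT.le_of_mem_chainTo hv₂m.1) fun e =>
    (mem_sdiff.1 hv₂m.2).2 (e ▸ hvV)
  have hunion : (T.restrict V).chainTo v ∪ (T.restrict (T.verts \ V)).chainTo v₂ =
      T.chainTo v := by
    rw [restrict_chainTo hT hV hv hne1 hmV1 hvV, restrict_chainTo hT hW hv hne hmW1 hv₂m.2,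
      hT.chainTo_of_mem hv₂m.1]
    ext y
    simp only [mem_union, mem_inter, mem_filter]
    constructor
    · rintro (h | h)
      · exact h.1
      · exact h.1.1
    · intro h
      by_cases hy : y ∈ V
      · exact Or.inl ⟨h, hy⟩
      · have hy' : y ∈ T.verts \ V := mem_sdiff.2 ⟨chainTo_subset h, hy⟩
        exact Or.inr ⟨⟨h, le_max' _ _ (mem_inter.2 ⟨h, hy'⟩)⟩, hy'⟩
  refine ⟨T.restrict V, T.restrict (T.verts \ V), v₂, hS, hlt,
    restrict_compat hT hV hv hne1 hmV1 hc fun x hx => (htV x (hV hx)).2 hx,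
    restrict_compat hT hW hv hne hmW1 hc fun x hx => ?_, fun x hx => ?_, rfl, rfl, ?_⟩
  · rw [mem_sdiff] at hx ⊢
    exact ⟨(hc x hx.1).1, fun h => hx.2 ((htV x hx.1).1 h)⟩
  · have hx : x ∈ V := hx
    have e : ∀ y ∈ (V : Set ℕ), link top T v y = link top (T.restrict V) v y := fun y hy => by
      rw [link, link, restrict_meet hT hV hv hne1 hmV1 hy hvV]
    refine (Reaches.congr (S := (V : Set ℕ)) (fun y hy => ?_) e ((htV x (hV hx)).2 hx)).1
      (mem_linkClass.1 hx).2
    exact (htV _ (chainTo_subset (hT.meet_mem (hV hy) hv).1)).2 (hmV1 y hy)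
  · refine LTree.ext ?_ (funext fun x => ?_)
    · exact (union_sdiff_of_subset hV).symm
    · by_cases hxT : x ∈ T.verts
      · by_cases hxv : x ∈ T.chainTo v
        · rw [Splicing.father_of_mem (by rwa [hunion]), hunion, hT.father_eq_pred_of_mem hxv]
        · by_cases hx : x ∈ V
          · rw [hS.father_left hx, restrict_father hT hV hv hmV1 hx hxv]
            · exact fun x hx h => (hmV x hx).1 h
            · rw [restrict_chainTo hT hV hv hne1 hmV1 hvV]
              exact fun h => hxv (mem_inter.1 h).1
          · have hx' : x ∈ T.verts \ V := mem_sdiff.2 ⟨hxT, hx⟩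
            rw [hS.father_right hx', restrict_father hT hW hv hmW1 hx' hxv hmW2]
            rw [restrict_chainTo hT hW hv hne hmW1 hv₂m.2]
            exact fun h => hxv (hT.chainTo_trans hv₂m.1 (mem_inter.1 h).1)
      · rw [hT.2.1 x hxT, hS.isIncreasingTree.2.1 x]
        exact fun h => hxT ((mem_union.1 h).elim (fun h => hV h) fun h => hW h)

end LTree

/-! ### Blocks and their maxima -/

namespace SetPartition

variable {S : Finset ℕ} {π : Finpartition S} {i j x y : ℕ}

/-- The maximum of the block of `x`. -/
noncomputable def blockMax (π : Finpartition S) (x : ℕ) : ℕ := (π.part x).sup id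

theorem isGreatest_blockMax (hx : x ∈ S) : IsGreatest (π.part x : Set ℕ) (blockMax π x) := by
  obtain ⟨m, hm, e⟩ := Finset.exists_mem_eq_sup (π.part x) ⟨x, π.mem_part hx⟩ id
  refine ⟨?_, fun y hy => Finset.le_sup (f := id) hy⟩
  rw [blockMax, e]
  exact hm

theorem le_blockMax (hx : x ∈ S) : x ≤ blockMax π x :=
  (isGreatest_blockMax hx).2 (π.mem_part hx)

theorem blockMax_mem (hx : x ∈ S) : blockMax π x ∈ S :=
  π.part_subset x (isGreatest_blockMax hx).1

theorem part_blockMax (hx : x ∈ S) : π.part (blockMax π x) = π.part x :=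
  π.part_eq_of_mem (π.part_mem.2 hx) (isGreatest_blockMax hx).1

theorem blockMax_of_notMem (hx : x ∉ S) : blockMax π x = 0 := by
  rw [blockMax, π.part_eq_empty.2 hx]
  rfl

theorem part_eq_iff (hx : x ∈ S) (hy : y ∈ S) :
    π.part x = π.part y ↔ blockMax π x = blockMax π y := by
  constructor
  · intro h
    rw [blockMax, h, ← blockMax]
  · intro h
    rw [← part_blockMax hx, h, part_blockMax hy]

theorem blockMax_eq_iff {m : ℕ} : (∃ B ∈ π.parts, IsGreatest (B : Set ℕ) m) ↔
    m ∈ S ∧ blockMax π m = m := by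
  constructor
  · rintro ⟨B, hB, hm⟩
    have hmS : m ∈ S := π.le hB hm.1
    refine ⟨hmS, ?_⟩
    have := isGreatest_blockMax (π := π) hmS
    rw [π.part_eq_of_mem hB hm.1] at this
    exact this.unique hm
  · rintro ⟨hm, h⟩
    have := isGreatest_blockMax (π := π) hm
    rw [h] at this
    exact ⟨_, π.part_mem.2 hm, this⟩

theorem setOf_isGreatest_eq (π : Finpartition S) :
    {m | ∃ B ∈ π.parts, IsGreatest (B : Set ℕ) m} = (S.filter fun m => blockMax π m = m) := by
  ext m
  simp only [Set.mem_ofPred_eq, blockMax_eq_iff, coe_filter]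

theorem finite_isGreatest (π : Finpartition S) :
    {m | ∃ B ∈ π.parts, IsGreatest (B : Set ℕ) m}.Finite := by
  rw [setOf_isGreatest_eq]
  exact finite_toSet _

theorem card_isGreatest (π : Finpartition S) :
    (finite_isGreatest π).toFinset.card = numBlocks π := by
  have : (finite_isGreatest π).toFinset = S.filter fun m => blockMax π m = m := by
    ext m
    rw [Set.Finite.mem_toFinset, setOf_isGreatest_eq, mem_coe]
  rw [this, numBlocks]
  refine card_bij (fun m _ => π.part m) (fun m hm => π.part_mem.2 (mem_filter.1 hm).1) ?_ ?_
  · intro a ha b hb h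
    rw [mem_filter] at ha hb
    have := (part_eq_iff ha.1 hb.1).1 h
    rwa [ha.2, hb.2] at this
  · intro B hB
    obtain ⟨x, hx⟩ := π.nonempty_of_mem_parts hB
    have hxS := π.le hB hx
    refine ⟨blockMax π x, mem_filter.2 ⟨blockMax_mem hxS, ?_⟩, ?_⟩
    · exact (part_eq_iff (blockMax_mem hxS) hxS).1 (part_blockMax hxS)
    · rw [part_blockMax hxS, π.part_eq_of_mem hB hx]

/-- Outside `S` the maximum takes the default value `0`, which must itself lie outside `S` for
idempotence at every argument. -/
theorem blockMax_blockMax (h0 : 0 ∉ S) (x : ℕ) : blockMax π (blockMax π x) = blockMax π x := by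
  by_cases hx : x ∈ S
  · exact (part_eq_iff (blockMax_mem hx) hx).1 (part_blockMax hx)
  · rw [blockMax_of_notMem hx, blockMax_of_notMem h0]

theorem mu_spec (h1 : 1 ≤ i) (hi : i ≤ numBlocks π) : mu π i ∈ S ∧ blockMax π (mu π i) = mu π i :=
  blockMax_eq_iff.1 (Nat.nth_mem_of_lt_card (finite_isGreatest π) (by
    rw [card_isGreatest]; omega))

theorem mu_lt (h1 : 1 ≤ i) (hij : i < j) (hj : j ≤ numBlocks π) : mu π i < mu π j :=
  Nat.nth_lt_nth_of_lt_card (finite_isGreatest π) (by omega) (by rw [card_isGreatest]; omega)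

theorem mu_inj (h1 : 1 ≤ i) (hi : i ≤ numBlocks π) (h1' : 1 ≤ j) (hj : j ≤ numBlocks π)
    (h : mu π i = mu π j) : i = j := by
  rcases lt_trichotomy i j with hlt | hlt | hlt
  · have := mu_lt h1 hlt hj; omega
  · exact hlt
  · have := mu_lt h1' hlt hi; omega

theorem exists_mu (hx : x ∈ S) : ∃ i, 1 ≤ i ∧ i ≤ numBlocks π ∧ blockMax π x = mu π i := by
  have hb : ∃ B ∈ π.parts, IsGreatest (B : Set ℕ) (blockMax π x) :=
    ⟨_, π.part_mem.2 hx, isGreatest_blockMax hx⟩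
  obtain ⟨n, hn, e⟩ := Nat.exists_lt_card_finite_nth_eq (finite_isGreatest π) hb
  rw [card_isGreatest] at hn
  exact ⟨n + 1, by omega, by omega, e.symm⟩

theorem mem_block (h1 : 1 ≤ i) (hi : i ≤ numBlocks π) :
    x ∈ block π i ↔ x ∈ S ∧ blockMax π x = mu π i := by
  have hm := mu_spec h1 hi
  rw [block]
  constructor
  · intro h
    have hx := π.part_subset _ h
    refine ⟨hx, ?_⟩
    rw [← hm.2, ← part_eq_iff hx hm.1]
    exact π.part_eq_of_mem (π.part_mem.2 hm.1) h
  · rintro ⟨hx, h⟩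
    rw [← hm.2, ← part_eq_iff hx hm.1] at h
    rw [← h]
    exact π.mem_part hx

section

variable {r : ℕ} {π : Finpartition (Icc 1 r)}

theorem one_isGreatest (hπ : {1} ∈ π.parts) :
    blockMax π 1 = 1 ∧ ∀ x ∈ Icc 1 r, blockMax π x = 1 → x = 1 := by
  constructor
  · exact (blockMax_eq_iff.1 ⟨_, hπ, by simp⟩).2
  · intro x hx h
    have := le_blockMax (π := π) hx
    have := (mem_Icc.1 hx).1
    omega

theorem two_le_numBlocks (hr : 2 ≤ r) (hπ : {1} ∈ π.parts) : 2 ≤ numBlocks π := by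
  obtain ⟨h1, h2⟩ := one_isGreatest hπ
  have hm1 : 1 ∈ Icc 1 r := mem_Icc.2 ⟨le_rfl, by omega⟩
  have hm2 : 2 ∈ Icc 1 r := mem_Icc.2 ⟨by omega, hr⟩
  obtain ⟨i, hi1, hi2, e⟩ := exists_mu (π := π) hm1
  obtain ⟨j, hj1, hj2, e'⟩ := exists_mu (π := π) hm2
  by_contra hk
  have : i = j := by omega
  subst this
  have := h2 2 hm2 (by rw [e', ← e, h1])
  omega

theorem mu_one (hr : 2 ≤ r) (hπ : {1} ∈ π.parts) : mu π 1 = 1 := by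
  obtain ⟨h1, -⟩ := one_isGreatest hπ
  obtain ⟨i, hi1, hi2, e⟩ := exists_mu (π := π) (mem_Icc.2 ⟨le_rfl, by omega⟩ : 1 ∈ Icc 1 r)
  rw [h1] at e
  rcases hi1.eq_or_lt with h | h
  · subst h
    exact e.symm
  · have := mu_lt le_rfl h hi2
    have := (mem_Icc.1 (mu_spec (π := π) le_rfl (by omega)).1).1
    omega

/-- Two elements of a block on the chain to its maximum are comparable, so only the chains to the
maxima have to be tested. -/
theorem mem_treeSet {T : LTree} : T ∈ treeSet π ↔
    T.IsIncreasingTree ∧ T.verts = Icc 1 r ∧ T.Compat (blockMax π) := by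
  refine and_congr_right fun hT => and_congr_right fun hv => ?_
  constructor
  · intro h x hx
    rw [hv] at hx
    have hb := blockMax_mem (π := π) hx
    rw [hv]
    refine ⟨hb, ?_⟩
    rw [LTree.mem_chainTo, hv]
    refine ⟨hx, ?_⟩
    rcases (le_blockMax (π := π) hx).eq_or_lt with h' | h'
    · exact Or.inl h'
    · exact Or.inr (h _ (π.part_mem.2 hx) x (π.mem_part hx) _ (isGreatest_blockMax hx).1 h')
  · intro h B hB i hi j hj hij
    have hiS := π.le hB hi
    have hjS := π.le hB hj
    have e : blockMax π i = blockMax π j := by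
      rw [← part_eq_iff hiS hjS, π.part_eq_of_mem hB hi, π.part_eq_of_mem hB hj]
    have h1 := (h i (hv ▸ hiS)).2
    have h2 := (h j (hv ▸ hjS)).2
    rw [e] at h1
    rcases (LTree.mem_chainTo.1 (hT.mem_chainTo_of_le h2 h1 hij.le)).2 with h3 | h3
    · omega
    · exact h3

end

end SetPartition

/-! ### Forests of components and the inversion of one splice -/

namespace SetPartition

variable {r : ℕ} {π : Finpartition (Icc 1 r)} {i j l u c ν ν' x : ℕ} {τ τ' σ σ' : ℕ → LTree}

/-- The indices of the components present before Stage `i`. -/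
def active (π : Finpartition (Icc 1 r)) (i : ℕ) : Finset ℕ := insert 1 (Icc i (numBlocks π))

theorem mem_active : j ∈ active π i ↔ j = 1 ∨ i ≤ j ∧ j ≤ numBlocks π := by
  simp [active]

theorem active_succ_subset : active π (i + 1) ⊆ active π i := fun j hj => by
  rw [mem_active] at hj ⊢
  omega

/-- The families of components that can be present before Stage `i`. -/
structure IsForest (π : Finpartition (Icc 1 r)) (i : ℕ) (τ : ℕ → LTree) : Prop where
  tree : ∀ j ∈ active π i, (τ j).IsIncreasingTree
  compat : ∀ j ∈ active π i, (τ j).Compat (blockMax π)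
  disj : ∀ j ∈ active π i, ∀ l ∈ active π i, j ≠ l → Disjoint (τ j).verts (τ l).verts
  subset : ∀ j ∈ active π i, (τ j).verts ⊆ Icc 1 r
  cover : ∀ x ∈ Icc 1 r, ∃ j ∈ active π i, x ∈ (τ j).verts
  mu_mem : ∀ j ∈ active π i, mu π j ∈ (τ j).verts
  -- Stages have `i ≥ 2`, so the component of index `1` is not covered; for it the root argument
  -- replaces linkedness.
  linked : ∀ j, i ≤ j → j ≤ numBlocks π → (τ j).Linked (blockMax π) (mu π j)

/-- `τ'` arises from `τ` by splicing `τ_i` into `τ_j` at the vertex `u`. -/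
structure IsSpliceStep (π : Finpartition (Icc 1 r)) (i j u : ℕ) (τ τ' : ℕ → LTree) : Prop where
  eq_splice : τ' j = (τ i).splice (mu π i) (τ j) u
  eq_of_ne : ∀ l ∈ active π (i + 1), l ≠ j → τ' l = τ l

namespace IsForest

section

variable (h : IsForest π i τ)
include h

theorem eq_of_mem (hj : j ∈ active π i) (hl : l ∈ active π i) (hx : x ∈ (τ j).verts)
    (hx' : x ∈ (τ l).verts) : j = l := by
  by_contra hne
  exact disjoint_left.1 (h.disj j hj l hl hne) hx hx'

/-- A block whose index is at least `i` can only lie in the component of its index. -/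
theorem index_lt_or_eq (hj : j ∈ active π i) (hx : x ∈ (τ j).verts) :
    ∃ m, 1 ≤ m ∧ m ≤ numBlocks π ∧ blockMax π x = mu π m ∧ (m < i ∨ m = j) := by
  obtain ⟨m, h1, hm, e⟩ := exists_mu (π := π) (h.subset j hj hx)
  refine ⟨m, h1, hm, e, ?_⟩
  by_cases hmi : m < i
  · exact Or.inl hmi
  · right
    have hma : m ∈ active π i := mem_active.2 (Or.inr ⟨by omega, hm⟩)
    exact h.eq_of_mem hma hj (h.mu_mem m hma) (e ▸ (h.compat j hj x hx).1)

variable (h2 : 2 ≤ i)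
include h2

/-- Only blocks of index below `i` have been merged into `τ_1`. This provides `ν < μ_i`, as the
splice requires. -/
theorem lt_mu (hi : i ≤ numBlocks π) (hx : x ∈ (τ 1).verts) : x < mu π i := by
  have h1 : 1 ∈ active π i := mem_active.2 (Or.inl rfl)
  obtain ⟨m, hm1, hm, e, h'⟩ := h.index_lt_or_eq h1 hx
  have := mu_lt hm1 (by omega : m < i) hi
  have := le_blockMax (π := π) (h.subset 1 h1 hx)
  omega

theorem le_mu (hi : i ≤ numBlocks π) (hx : x ∈ (τ i).verts) : x ≤ mu π i := by
  have h1 : i ∈ active π i := mem_active.2 (Or.inr ⟨le_rfl, hi⟩)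
  obtain ⟨m, hm1, hm, e, h'⟩ := h.index_lt_or_eq h1 hx
  have hle := le_blockMax (π := π) (h.subset i h1 hx)
  rcases h' with h' | rfl
  · have := mu_lt hm1 h' hi
    omega
  · omega

variable (hi : i ≤ numBlocks π) (hj : j ∈ active π (i + 1)) (hu : u ∈ (τ j).verts)
include hi hj hu

theorem splicing : LTree.Splicing (τ i) (mu π i) (τ j) u := by
  have hia : i ∈ active π i := mem_active.2 (Or.inr ⟨le_rfl, hi⟩)
  have hja := active_succ_subset hj
  have hij : i ≠ j := by
    rw [mem_active] at hj
    omega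
  exact ⟨h.tree i hia, h.tree j hja, h.disj i hia j hja hij, h.mu_mem i hia, hu⟩

theorem step (hlt : u < mu π i) (hs : IsSpliceStep π i j u τ τ') : IsForest π (i + 1) τ' := by
  have hS := h.splicing h2 hi hj hu
  have hia : i ∈ active π i := mem_active.2 (Or.inr ⟨le_rfl, hi⟩)
  have hja := active_succ_subset hj
  have hverts : (τ' j).verts = (τ i).verts ∪ (τ j).verts := by rw [hs.eq_splice]; rfl
  have hil : ∀ l ∈ active π (i + 1), i ≠ l := fun l hl => by
    rw [mem_active] at hl
    omega
  have hdisj : ∀ l ∈ active π (i + 1), l ≠ j → Disjoint (τ' j).verts (τ' l).verts := by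
    intro l hl hlj
    rw [hverts, hs.eq_of_ne l hl hlj, disjoint_union_left]
    exact ⟨h.disj i hia l (active_succ_subset hl) (hil l hl),
      h.disj j hja l (active_succ_subset hl) hlj.symm⟩
  refine ⟨fun l hl => ?_, fun l hl => ?_, fun l hl m hm hlm => ?_, fun l hl => ?_, fun x hx => ?_,
    fun l hl => ?_, fun l h1 h2 => ?_⟩
  · rcases eq_or_ne l j with rfl | hlj
    · rw [hs.eq_splice]; exact hS.isIncreasingTree
    · rw [hs.eq_of_ne l hl hlj]; exact h.tree l (active_succ_subset hl)
  · rcases eq_or_ne l j with rfl | hlj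
    · rw [hs.eq_splice]; exact hS.compat (h.compat i hia) (h.compat l hja)
    · rw [hs.eq_of_ne l hl hlj]; exact h.compat l (active_succ_subset hl)
  · rcases eq_or_ne l j with rfl | hlj
    · exact hdisj m hm hlm.symm
    · rcases eq_or_ne m j with rfl | hmj
      · exact (hdisj l hl hlj).symm
      · rw [hs.eq_of_ne l hl hlj, hs.eq_of_ne m hm hmj]
        exact h.disj l (active_succ_subset hl) m (active_succ_subset hm) hlm
  · rcases eq_or_ne l j with rfl | hlj
    · rw [hverts]; exact union_subset (h.subset i hia) (h.subset l hja)
    · rw [hs.eq_of_ne l hl hlj]; exact h.subset l (active_succ_subset hl)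
  · obtain ⟨l, hl, hxl⟩ := h.cover x hx
    by_cases hlij : l = i ∨ l = j
    · refine ⟨j, hj, ?_⟩
      rw [hverts, mem_union]
      rcases hlij with rfl | rfl
      · exact Or.inl hxl
      · exact Or.inr hxl
    · rw [not_or] at hlij
      have hl' : l ∈ active π (i + 1) := by
        rw [mem_active] at hl ⊢
        omega
      exact ⟨l, hl', by rwa [hs.eq_of_ne l hl' hlij.2]⟩
  · rcases eq_or_ne l j with rfl | hlj
    · rw [hverts]; exact mem_union_right _ (h.mu_mem l hja)
    · rw [hs.eq_of_ne l hl hlj]; exact h.mu_mem l (active_succ_subset hl)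
  · have hl : l ∈ active π (i + 1) := mem_active.2 (Or.inr ⟨h1, h2⟩)
    rcases eq_or_ne l j with rfl | hlj
    · rw [hs.eq_splice]
      exact (hS.linked_iff hlt (h.compat i hia) (h.compat l hja) (h.linked i le_rfl hi)
        (h.mu_mem l hja)).2 (h.linked l (by omega) h2)
    · rw [hs.eq_of_ne l hl hlj]; exact h.linked l (by omega) h2

-- The index `j` is read off as that of the component containing `μ_i`; the uniqueness of the splice
-- then gives the rest.
omit h hu in
theorem step_unique {j' u' : ℕ} (h : IsForest π i τ) (hu : u ∈ (τ j).verts) (hlt : u < mu π i)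
    (hs : IsSpliceStep π i j u τ τ')
    (h' : IsForest π i σ) (hj' : j' ∈ active π (i + 1)) (hu' : u' ∈ (σ j').verts)
    (hlt' : u' < mu π i) (hs' : IsSpliceStep π i j' u' σ σ')
    (e : ∀ l ∈ active π (i + 1), τ' l = σ' l) :
    j = j' ∧ u = u' ∧ ∀ l ∈ active π i, τ l = σ l := by
  have hia : i ∈ active π i := mem_active.2 (Or.inr ⟨le_rfl, hi⟩)
  have hF := h.step h2 hi hj hu hlt hs
  have m1 : mu π i ∈ (τ' j).verts := by
    rw [hs.eq_splice]; exact mem_union_left _ (h.mu_mem i hia)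
  have m2 : mu π i ∈ (τ' j').verts := by
    rw [e j' hj', hs'.eq_splice]; exact mem_union_left _ (h'.mu_mem i hia)
  obtain rfl := hF.eq_of_mem hj hj' m1 m2
  have hja := active_succ_subset hj
  obtain ⟨e1, e2, e3⟩ := LTree.Splicing.unique (h.splicing h2 hi hj hu) (h'.splicing h2 hi hj hu')
    hlt hlt' (h.compat i hia) (h.compat j hja) (h'.compat i hia) (h'.compat j hja)
    (h.linked i le_rfl hi) (h'.linked i le_rfl hi)
    (by rw [← hs.eq_splice, ← hs'.eq_splice, e j hj])
  refine ⟨rfl, e3, fun l hl => ?_⟩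
  rcases eq_or_ne l i with rfl | hli
  · exact e1
  rcases eq_or_ne l j with rfl | hlj
  · exact e2
  have hl' : l ∈ active π (i + 1) := by
    rw [mem_active] at hl ⊢
    omega
  rw [← hs.eq_of_ne l hl' hlj, ← hs'.eq_of_ne l hl' hlj, e l hl']

end

/-- The component containing `μ_i` is split along the link class of `μ_i`. The remainder keeps the
index `j`, which is legitimate because `μ_j` stays outside the class. -/
theorem exists_step (hr : 2 ≤ r) (hπ : {1} ∈ π.parts) (h2 : 2 ≤ i) (hi : i ≤ numBlocks π)
    (h : IsForest π (i + 1) τ') :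
    ∃ τ j u, IsForest π i τ ∧ j ∈ active π (i + 1) ∧ u ∈ (τ j).verts ∧ u < mu π i ∧
      IsSpliceStep π i j u τ τ' := by
  have h0 : 0 ∉ Icc 1 r := by simp
  have hmi := mu_spec (π := π) (by omega : 1 ≤ i) hi
  obtain ⟨j, hj, hij⟩ := h.cover _ hmi.1
  have hT := h.tree j hj
  have hc := h.compat j hj
  have hj1 : 1 ≤ j ∧ j ≤ numBlocks π ∧ j ≠ i := by
    rw [mem_active] at hj
    omega
  have hmj := mu_spec (π := π) hj1.1 hj1.2.1
  have hne : mu π j ≠ mu π i := fun e =>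
    hj1.2.2 (mu_inj hj1.1 hj1.2.1 (by omega) hi e)
  have hnot : mu π j ∉ LTree.linkClass (blockMax π) (τ' j) (mu π i) := by
    rw [mem_active] at hj
    rcases hj with rfl | hj
    · refine hT.root_notMem_linkClass (h.mu_mem 1 (mem_active.2 (Or.inl rfl))) hij hmj.2 ?_ hne
      rw [mu_one hr hπ]
      exact fun y hy => hT.1 y hy
    · exact hT.notMem_linkClass hc (h.linked j hj.1 hj.2) hij
        (h.mu_mem j (mem_active.2 (Or.inr hj))) hmi.2 hmj.2 hne.symm
  have hmW : mu π j ∈ (τ' j).verts \ LTree.linkClass (blockMax π) (τ' j) (mu π i) :=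
    mem_sdiff.2 ⟨h.mu_mem j hj, hnot⟩
  obtain ⟨T₁, T₂, u, hS, hlt, hc₁, hc₂, hl, hV₁, hV₂, e⟩ :=
    hT.exists_splice hc (blockMax_blockMax h0) hij hmi.2 ⟨_, hmW⟩
  have hsub₁ : T₁.verts ⊆ (τ' j).verts := by
    rw [hV₁]; exact fun x hx => (LTree.mem_linkClass.1 hx).1
  have hsub₂ : T₂.verts ⊆ (τ' j).verts := by rw [hV₂]; exact sdiff_subset
  set τ : ℕ → LTree := Function.update (Function.update τ' j T₂) i T₁ with hτ
  have ei : τ i = T₁ := by simp [hτ]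
  have ej : τ j = T₂ := by simp [hτ, hj1.2.2]
  have el : ∀ l, l ≠ i → l ≠ j → τ l = τ' l := fun l h1 h2 => by simp [hτ, h1, h2]
  have hcases : ∀ l ∈ active π i, l = i ∨ l = j ∨ l ∈ active π (i + 1) ∧ l ≠ j ∧ τ l = τ' l := by
    intro l hl
    by_cases h1 : l = i
    · exact Or.inl h1
    by_cases h2 : l = j
    · exact Or.inr (Or.inl h2)
    refine Or.inr (Or.inr ⟨?_, h2, el l h1 h2⟩)
    rw [mem_active] at hl ⊢
    omega
  refine ⟨τ, j, u, ⟨fun l hl => ?_, fun l hl => ?_, fun l hl m hm hlm => ?_, fun l hl => ?_,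
    fun x hx => ?_, fun l hl => ?_, fun l h1 h2 => ?_⟩, hj, by rw [ej]; exact hS.mem_right, hlt,
    by rw [ei, ej]; exact e, fun l hl hlj => (el l ?_ hlj).symm⟩
  · rcases hcases l hl with rfl | rfl | ⟨hl', hlj, e'⟩
    · rw [ei]; exact hS.left
    · rw [ej]; exact hS.right
    · rw [e']; exact h.tree l hl'
  · rcases hcases l hl with rfl | rfl | ⟨hl', hlj, e'⟩
    · rw [ei]; exact hc₁
    · rw [ej]; exact hc₂
    · rw [e']; exact h.compat l hl'
  · rcases hcases l hl with rfl | rfl | ⟨hl', hlj, e'⟩ <;>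
      rcases hcases m hm with rfl | rfl | ⟨hm', hmj, e''⟩
    · exact absurd rfl hlm
    · rw [ei, ej]; exact hS.disj
    · rw [ei, e'']; exact (h.disj j hj m hm' hmj.symm).mono_left hsub₁
    · rw [ei, ej]; exact hS.disj.symm
    · exact absurd rfl hlm
    · rw [ej, e'']; exact (h.disj l hj m hm' hmj.symm).mono_left hsub₂
    · rw [ei, e']; exact (h.disj l hl' j hj hlj).mono_right hsub₁
    · rw [ej, e']; exact (h.disj l hl' m hj hlj).mono_right hsub₂
    · rw [e', e'']; exact h.disj l hl' m hm' hlm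
  · rcases hcases l hl with rfl | rfl | ⟨hl', hlj, e'⟩
    · rw [ei]; exact hsub₁.trans (h.subset j hj)
    · rw [ej]; exact hsub₂.trans (h.subset l hj)
    · rw [e']; exact h.subset l hl'
  · obtain ⟨l, hl, hxl⟩ := h.cover x hx
    rcases eq_or_ne l j with rfl | hlj
    · by_cases hx1 : x ∈ T₁.verts
      · exact ⟨i, mem_active.2 (Or.inr ⟨le_rfl, hi⟩), by rwa [ei]⟩
      · refine ⟨l, active_succ_subset hl, ?_⟩
        rw [ej, hV₂, ← hV₁]
        exact mem_sdiff.2 ⟨hxl, hx1⟩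
    · refine ⟨l, active_succ_subset hl, ?_⟩
      rw [el l _ hlj]
      · exact hxl
      · rw [mem_active] at hl
        omega
  · rcases hcases l hl with rfl | rfl | ⟨hl', hlj, e'⟩
    · rw [ei]; exact hS.mem_left
    · rw [ej, hV₂]; exact hmW
    · rw [e']; exact h.mu_mem l hl'
  · rcases hcases l (mem_active.2 (Or.inr ⟨h1, h2⟩)) with rfl | rfl | ⟨hl', hlj, e'⟩
    · rw [ei]; exact hl
    · rw [ej]
      -- The invariant passes from the splice back to its second tree.
      rw [← hS.linked_iff hlt hc₁ hc₂ hl (by rw [hV₂]; exact hmW), ← e]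
      exact h.linked l (by omega) h2
    · rw [e']
      refine h.linked l ?_ h2
      rw [mem_active] at hl'
      omega
  · rw [mem_active] at hl
    omega

/-- Before Stage `2`, the components are the chains of the blocks. -/
theorem eq_ofChain (h : IsForest π 2 τ) (hj : j ∈ active π 2) (hk : 1 ≤ numBlocks π) : τ j = LTree.ofChain (block π j) := by
  have hact : ∀ m, 1 ≤ m → m ≤ numBlocks π → m ∈ active π 2 := fun m h1 h2 =>
    mem_active.2 (by omega)
  obtain ⟨h1, hjk⟩ : 1 ≤ j ∧ j ≤ numBlocks π := by
    rw [mem_active] at hj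
    omega
  have hT := h.tree j hj
  have hv : (τ j).verts = block π j := by
    ext x
    rw [mem_block h1 hjk]
    constructor
    · intro hx
      refine ⟨h.subset j hj hx, ?_⟩
      obtain ⟨m, hm1, hm, e⟩ := exists_mu (π := π) (h.subset j hj hx)
      have hma := hact m hm1 hm
      obtain rfl := h.eq_of_mem hma hj (h.mu_mem m hma) (e ▸ (h.compat j hj x hx).1)
      exact e
    · rintro ⟨hx, e⟩
      obtain ⟨l, hl, hxl⟩ := h.cover x hx
      obtain rfl := h.eq_of_mem hl hj (e ▸ (h.compat l hl x hxl).1) (h.mu_mem j hj)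
      exact hxl
  have hb : ∀ x ∈ (τ j).verts, blockMax π x = mu π j := fun x hx =>
    ((mem_block h1 hjk).1 (hv ▸ hx)).2
  refine LTree.ext hv (funext fun x => ?_)
  by_cases hx : x ∈ (τ j).verts
  · rw [show (LTree.ofChain (block π j)).father x = LTree.pred (block π j) x from if_pos (hv ▸ hx),
      hT.father_eq_pred hx]
    refine LTree.pred_congr fun y hy => ⟨fun h' => hv ▸ LTree.chainTo_subset h', fun h' => ?_⟩
    rw [← hv] at h'
    have e1 := (h.compat j hj x hx).2
    have e2 := (h.compat j hj y h').2
    rw [hb y h'] at e2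
    rw [hb x hx] at e1
    exact hT.mem_chainTo_of_le e1 e2 hy.le
  · rw [hT.2.1 x hx]
    exact (if_neg (hv ▸ hx)).symm

end IsForest

end SetPartition

/-! ### The initial forest of chains -/

namespace LTree

variable {B : Finset ℕ} {top : ℕ → ℕ} {x : ℕ}

theorem ofChain_isIncreasingTree (h0 : 0 ∉ B) (hB : B.Nonempty) : (ofChain B).IsIncreasingTree := by
  have hpos : ∀ x ∈ B, 0 < x := fun x hx => Nat.pos_of_ne_zero fun e => h0 (e ▸ hx)
  have hf : ∀ x ∈ B, (ofChain B).father x = pred B x := fun x hx => if_pos hx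
  refine ⟨hpos, fun v hv => if_neg hv, ⟨B.min' hB, ⟨B.min'_mem hB, ?_⟩, ?_⟩, fun v hv hv0 => ?_⟩
  · rw [hf _ (B.min'_mem hB)]
    exact pred_eq_zero fun y hy => B.min'_le y hy
  · rintro y ⟨hy, hy0⟩
    have hy : y ∈ B := hy
    rw [hf y hy] at hy0
    rcases pred_spec B y with h | h
    · have := hpos _ h.1
      omega
    · exact le_antisymm (h.2 _ (B.min'_mem hB)) (B.min'_le y hy)
  · have hv : v ∈ B := hv
    rw [hf v hv] at hv0 ⊢
    rcases pred_spec B v with h | h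
    · exact h
    · exact absurd h.1 hv0

theorem ofChain_chainTo (h0 : 0 ∉ B) (hx : x ∈ B) :
    (ofChain B).chainTo x = B.filter (· ≤ x) := by
  have hT := ofChain_isIncreasingTree h0 ⟨x, hx⟩
  induction x using Nat.strong_induction_on with
  | _ x ih =>
    rw [chainTo_eq_insert (T := ofChain B) hx, show (ofChain B).father x = pred B x from if_pos hx]
    rcases pred_spec B x with h' | h'
    · rw [ih _ h'.2 h'.1]
      ext y
      simp only [mem_insert, mem_filter]
      constructor
      · rintro (rfl | ⟨h1, h2⟩)
        · exact ⟨hx, le_rfl⟩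
        · exact ⟨h1, by omega⟩
      · rintro ⟨h1, h2⟩
        rcases h2.eq_or_lt with h3 | h3
        · exact Or.inl h3
        · exact Or.inr ⟨h1, le_pred h1 h3⟩
    · rw [h'.1, chainTo_eq_empty hT.zero_notMem]
      ext y
      simp only [mem_insert, mem_filter, notMem_empty, or_false]
      constructor
      · rintro rfl; exact ⟨hx, le_rfl⟩
      · rintro ⟨h1, h2⟩; exact le_antisymm h2 (h'.2 y h1)

end LTree

namespace SetPartition

variable {r : ℕ} {π : Finpartition (Icc 1 r)} {i j l u c ν ν' x : ℕ} {τ τ' σ σ' : ℕ → LTree}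

theorem isForest_two (hk : 2 ≤ numBlocks π) :
    IsForest π 2 fun l => LTree.ofChain (block π l) := by
  have hact : ∀ m, m ∈ active π 2 ↔ 1 ≤ m ∧ m ≤ numBlocks π := fun m => by
    rw [mem_active]
    omega
  have hb : ∀ m ∈ active π 2, ∀ x, x ∈ block π m ↔ x ∈ Icc 1 r ∧ blockMax π x = mu π m :=
    fun m hm x => mem_block ((hact m).1 hm).1 ((hact m).1 hm).2
  have hsub : ∀ m ∈ active π 2, block π m ⊆ Icc 1 r := fun m hm x hx => ((hb m hm x).1 hx).1
  have h0 : ∀ m ∈ active π 2, 0 ∉ block π m := fun m hm h => by simpa using hsub m hm h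
  have hmu : ∀ m ∈ active π 2, mu π m ∈ block π m := fun m hm =>
    (hb m hm _).2 (mu_spec ((hact m).1 hm).1 ((hact m).1 hm).2)
  refine ⟨fun j hj => LTree.ofChain_isIncreasingTree (h0 j hj) ⟨_, hmu j hj⟩, fun j hj x hx => ?_,
    fun j hj l hl hjl => ?_, hsub, fun x hx => ?_, hmu, fun j h1 h2 x hx => ?_⟩
  · have hx : x ∈ block π j := hx
    rw [((hb j hj x).1 hx).2]
    refine ⟨hmu j hj, ?_⟩
    rw [LTree.ofChain_chainTo (h0 j hj) (hmu j hj), mem_filter]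
    refine ⟨hx, ?_⟩
    rw [← ((hb j hj x).1 hx).2]
    exact le_blockMax (hsub j hj hx)
  · rw [disjoint_left]
    intro x hx hx'
    have e1 := ((hb j hj x).1 hx).2
    have e2 := ((hb l hl x).1 hx').2
    exact hjl (mu_inj ((hact j).1 hj).1 ((hact j).1 hj).2 ((hact l).1 hl).1 ((hact l).1 hl).2
      (e1.symm.trans e2))
  · obtain ⟨m, hm1, hm, e⟩ := exists_mu (π := π) hx
    have hma := (hact m).2 ⟨hm1, hm⟩
    exact ⟨m, hma, (hb m hma x).2 ⟨hx, e⟩⟩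
  · have hja := mem_active.2 (Or.inr ⟨h1, h2⟩)
    -- Every vertex has block maximum `μ_j` already, so no link step is needed.
    exact ⟨0, ((hb j hja x).1 hx).2⟩

end SetPartition

/-! ### Stages, states and bijectivity -/

namespace SetPartition

variable {r : ℕ} {π : Finpartition (Icc 1 r)} {i j l u c c' n : ℕ} {s t : (ℕ → LTree) × ℕ}

/-- The states that can be reached before Stage `i`. -/
structure IsValid (π : Finpartition (Icc 1 r)) (i : ℕ) (s : (ℕ → LTree) × ℕ) : Prop where
  forest : IsForest π i s.1
  mem : s.2 ∈ (s.1 1).verts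

/-- Equality of states, up to the components omitted before Stage `i`. -/
def Equiv (π : Finpartition (Icc 1 r)) (i : ℕ) (s t : (ℕ → LTree) × ℕ) : Prop :=
  s.2 = t.2 ∧ ∀ j ∈ active π i, s.1 j = t.1 j

theorem Equiv.trans {q : (ℕ → LTree) × ℕ} (h : Equiv π i s t) (h' : Equiv π i t q) :
    Equiv π i s q :=
  ⟨h.1.trans h'.1, fun j hj => (h.2 j hj).trans (h'.2 j hj)⟩

theorem one_mem_active : 1 ∈ active π i := mem_active.2 (Or.inl rfl)

theorem self_mem_active (hi : i ≤ numBlocks π) : i ∈ active π i :=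
  mem_active.2 (Or.inr ⟨le_rfl, hi⟩)

theorem Equiv.stage (e : Equiv π i s t) (hi : i ≤ numBlocks π) :
    Equiv π (i + 1) (stage π i c s) (stage π i c t) := by
  have h1 := e.2 1 one_mem_active
  have h2 := e.2 i (self_mem_active hi)
  have h3 : ∀ j ∈ active π (i + 1), s.1 j = t.1 j := fun j hj => e.2 j (active_succ_subset hj)
  unfold SetPartition.stage
  rw [h1, h2, e.1]
  split_ifs with hc
  · refine ⟨rfl, fun j hj => ?_⟩
    rcases eq_or_ne j 1 with rfl | hj1
    · simp
    · simpa [hj1] using h3 j hj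
  · exact ⟨rfl, fun j hj => by simp only [h3 j hj]⟩

theorem isSpliceStep_of_mem (hc : c ∈ (s.1 1).verts ∪ (s.1 i).verts) :
    IsSpliceStep π i 1 s.2 s.1 (stage π i c s).1 ∧ (stage π i c s).2 = c := by
  refine ⟨⟨?_, fun l _ hl => ?_⟩, ?_⟩
  · simp [stage, hc]
  · simp only [stage, if_pos hc]
    exact Function.update_of_ne hl _ _
  · simp only [stage, if_pos hc]

/-- In each stage, `τ_i` is spliced into one of the components that remain. -/
theorem IsValid.stage_spec (h : IsValid π i s) (h2 : 2 ≤ i) (hi : i ≤ numBlocks π) (hc1 : 1 ≤ c)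
    (hc : c ≤ mu π i) : ∃ j u, j ∈ active π (i + 1) ∧ u ∈ (s.1 j).verts ∧ u < mu π i ∧
      IsSpliceStep π i j u s.1 (stage π i c s).1 ∧
      (j = 1 ∧ u = s.2 ∧ (stage π i c s).2 = c ∧ c ∈ (s.1 1).verts ∪ (s.1 i).verts ∨
        j ≠ 1 ∧ u = c ∧ (stage π i c s).2 = s.2) := by
  have hia := self_mem_active (π := π) hi
  by_cases hcm : c ∈ (s.1 1).verts ∪ (s.1 i).verts
  · exact ⟨1, s.2, one_mem_active, h.mem, h.forest.lt_mu h2 hi h.mem,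
      (isSpliceStep_of_mem hcm).1, Or.inl ⟨rfl, rfl, (isSpliceStep_of_mem hcm).2, hcm⟩⟩
  · have hcS : c ∈ Icc 1 r :=
      mem_Icc.2 ⟨hc1, hc.trans (mem_Icc.1 (mu_spec (by omega : 1 ≤ i) hi).1).2⟩
    obtain ⟨j, hj, hcj⟩ := h.forest.cover c hcS
    rw [mem_union, not_or] at hcm
    have hj1 : j ≠ 1 := by rintro rfl; exact hcm.1 hcj
    have hji : j ≠ i := by rintro rfl; exact hcm.2 hcj
    have hij : i < j ∧ j ≤ numBlocks π := by
      rw [mem_active] at hj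
      omega
    have hcm' : c ∉ (s.1 1).verts ∪ (s.1 i).verts := by rwa [mem_union, not_or]
    refine ⟨j, c, mem_active.2 (Or.inr hij), hcj, lt_of_le_of_ne hc ?_, ⟨?_, fun l hl hlj => ?_⟩,
      Or.inr ⟨hj1, rfl, ?_⟩⟩
    · rintro rfl
      exact hcm.2 (h.forest.mu_mem i hia)
    · simp only [stage, if_neg hcm']
      rw [if_pos ⟨hij.1, hcj⟩]
    · simp only [stage, if_neg hcm']
      rw [if_neg]
      exact fun h' => hlj (h.forest.eq_of_mem (active_succ_subset hl) hj h'.2 hcj)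
    · simp only [stage, if_neg hcm']

theorem IsValid.stage (h : IsValid π i s) (h2 : 2 ≤ i) (hi : i ≤ numBlocks π) (hc1 : 1 ≤ c)
    (hc : c ≤ mu π i) : IsValid π (i + 1) (stage π i c s) := by
  obtain ⟨j, u, hj, hu, hlt, hs, h'⟩ := h.stage_spec h2 hi hc1 hc
  refine ⟨h.forest.step h2 hi hj hu hlt hs, ?_⟩
  rcases h' with ⟨rfl, rfl, e, hcm⟩ | ⟨hj1, rfl, e⟩
  · rw [e, hs.eq_splice]
    rw [union_comm] at hcm
    exact hcm
  · rw [e, hs.eq_of_ne 1 one_mem_active hj1.symm]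
    exact h.mem

/-- The target index of the splice tells which case of the stage occurred. If it is `1`, then `c` is
the new `ν` and the splicing vertex the old one; otherwise `c` is the splicing vertex and `ν` is
kept. -/
theorem IsValid.stage_unique (hs : IsValid π i s) (ht : IsValid π i t) (h2 : 2 ≤ i)
    (hi : i ≤ numBlocks π) (hc1 : 1 ≤ c) (hc : c ≤ mu π i) (hc1' : 1 ≤ c') (hc' : c' ≤ mu π i)
    (e : Equiv π (i + 1) (SetPartition.stage π i c s) (SetPartition.stage π i c' t)) :
    c = c' ∧ Equiv π i s t := by
  obtain ⟨j, u, hj, hu, hlt, hS, h⟩ := hs.stage_spec h2 hi hc1 hc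
  obtain ⟨j', u', hj', hu', hlt', hS', h'⟩ := ht.stage_spec h2 hi hc1' hc'
  obtain ⟨e1, e2, e3⟩ := hs.forest.step_unique h2 hi hj hu hlt hS ht.forest hj' hu' hlt' hS' e.2
  have e4 := e.1
  unfold Equiv
  rcases h with ⟨h1, h3, h4, -⟩ | ⟨h1, h3, h4⟩ <;>
    rcases h' with ⟨h1', h3', h4', -⟩ | ⟨h1', h3', h4'⟩
  · exact ⟨by omega, by omega, e3⟩
  · omega
  · omega
  · exact ⟨by omega, by omega, e3⟩

theorem IsValid.exists_stage (hr : 2 ≤ r) (hπ : {1} ∈ π.parts) (h : IsValid π (i + 1) t)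
    (h2 : 2 ≤ i) (hi : i ≤ numBlocks π) :
    ∃ s c, IsValid π i s ∧ 1 ≤ c ∧ c ≤ mu π i ∧ Equiv π (i + 1) (SetPartition.stage π i c s) t := by
  obtain ⟨τ, j, u, hF, hj, hu, hlt, hS⟩ := h.forest.exists_step hr hπ h2 hi
  have hia := self_mem_active (π := π) hi
  have hja := active_succ_subset hj
  have ht : ∀ ν c, IsSpliceStep π i j u τ (SetPartition.stage π i c (τ, ν)).1 →
      ∀ l ∈ active π (i + 1), (SetPartition.stage π i c (τ, ν)).1 l = t.1 l := by
    intro ν c h l hl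
    rcases eq_or_ne l j with rfl | hlj
    · rw [h.eq_splice, hS.eq_splice]
    · rw [h.eq_of_ne l hl hlj, hS.eq_of_ne l hl hlj]
  -- For `j = 1` the preimage has `ν = u` and `c = t.2`; otherwise it keeps `ν = t.2` and takes `c =
  -- u`.
  by_cases hj1 : j = 1
  · subst hj1
    have hv : IsValid π i (τ, u) := ⟨hF, hu⟩
    have hm := h.mem
    rw [hS.eq_splice] at hm
    have hc1 : 1 ≤ t.2 := (h.forest.tree 1 one_mem_active).1 _ h.mem
    have hc : t.2 ≤ mu π i := by
      rcases mem_union.1 hm with hm | hm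
      · exact hF.le_mu h2 hi hm
      · exact (hF.lt_mu h2 hi hm).le
    have hm' : t.2 ∈ (τ 1).verts ∪ (τ i).verts := by
      rw [union_comm]
      exact hm
    obtain ⟨hS', e⟩ := isSpliceStep_of_mem (π := π) (s := (τ, u)) hm'
    exact ⟨_, _, hv, hc1, hc, e, ht _ _ hS'⟩
  · have hm := h.mem
    rw [hS.eq_of_ne 1 one_mem_active (Ne.symm hj1)] at hm
    have hv : IsValid π i (τ, t.2) := ⟨hF, hm⟩
    have hc1 : 1 ≤ u := (hF.tree j hja).1 u hu
    obtain ⟨j', u', hj', hu', -, hS', h'⟩ := hv.stage_spec h2 hi hc1 hlt.le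
    rcases h' with ⟨rfl, rfl, e, hcm⟩ | ⟨h1, rfl, e⟩
    · exfalso
      rcases mem_union.1 hcm with hcm | hcm
      · exact hj1 (hF.eq_of_mem hja one_mem_active hu hcm)
      · have := hF.eq_of_mem hja hia hu hcm
        rw [mem_active] at hj
        omega
    · obtain rfl := hF.eq_of_mem (active_succ_subset hj') hja hu' hu
      exact ⟨_, _, hv, hc1, hlt.le, e, ht _ _ hS'⟩

variable {c c' : Fin (numBlocks π - 2) → ℕ}

theorem isValid_state (hr : 2 ≤ r) (hπ : {1} ∈ π.parts) (hc : c ∈ tupleSet π)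
    (hn : n ≤ numBlocks π - 2) : IsValid π (n + 2) (state π c n) := by
  have hk := two_le_numBlocks hr hπ
  induction n with
  | zero =>
    refine ⟨isForest_two hk, ?_⟩
    have := (isForest_two hk).mu_mem 1 one_mem_active
    rwa [mu_one hr hπ] at this
  | succ n ih =>
    rw [state, dif_pos (by omega)]
    exact (ih (by omega)).stage (by omega) (by omega) (hc _).1 (hc _).2

theorem equiv_state_zero (hr : 2 ≤ r) (hπ : {1} ∈ π.parts) (h : IsValid π 2 s) :
    Equiv π 2 (state π c 0) s := by
  have hk := two_le_numBlocks hr hπ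
  have hF : ∀ j ∈ active π 2, s.1 j = LTree.ofChain (block π j) := fun j hj =>
    h.forest.eq_ofChain hj (by omega)
  refine ⟨?_, fun j hj => (hF j hj).symm⟩
  have hm := h.mem
  have hlt := h.forest.subset 1 one_mem_active hm
  rw [hF 1 one_mem_active] at hm
  have hm : s.2 ∈ block π 1 := hm
  rw [mem_block le_rfl (by omega), mu_one hr hπ] at hm
  exact ((one_isGreatest hπ).2 _ hm.1 hm.2).symm

theorem state_congr (h : ∀ m : Fin (numBlocks π - 2), m.1 < n → c m = c' m) :
    state π c n = state π c' n := by
  induction n with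
  | zero => rfl
  | succ n ih =>
    have := ih fun m hm => h m (by omega)
    rw [state, state, this]
    split_ifs with h'
    · rw [h ⟨n, h'⟩ (Nat.lt_succ_self n)]
    · rfl

theorem exists_state (hr : 2 ≤ r) (hπ : {1} ∈ π.parts) (hn : n ≤ numBlocks π - 2)
    (h : IsValid π (n + 2) s) : ∃ c ∈ tupleSet π, Equiv π (n + 2) (state π c n) s := by
  induction n generalizing s with
  | zero =>
    -- The initial state ignores the tuple, so any admissible one serves; the inductive step
    -- overwrites its entries one by one.
    refine ⟨fun _ => 1, fun m => ⟨le_rfl, ?_⟩, equiv_state_zero hr hπ h⟩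
    exact (mem_Icc.1 (mu_spec (π := π) (i := m + 2) (by omega) (by omega)).1).1
  | succ n ih =>
    obtain ⟨t, a, ht, ha1, ha, e⟩ := h.exists_stage hr hπ (by omega) (by omega)
    obtain ⟨c, hc, e'⟩ := ih (by omega) ht
    refine ⟨Function.update c ⟨n, hn⟩ a, fun m => ?_, ?_⟩
    · rcases eq_or_ne m ⟨n, hn⟩ with rfl | hm
      · rw [Function.update_self]; exact ⟨ha1, ha⟩
      · rw [Function.update_of_ne hm]; exact hc m
    · rw [state, dif_pos (by omega), Function.update_self, state_congr (c' := c)]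
      · exact (e'.stage (by omega)).trans e
      · intro m hm
        rw [Function.update_of_ne]
        rintro rfl
        exact lt_irrefl _ hm

theorem state_injective (hr : 2 ≤ r) (hπ : {1} ∈ π.parts) (hc : c ∈ tupleSet π)
    (hc' : c' ∈ tupleSet π) (hn : n ≤ numBlocks π - 2)
    (e : Equiv π (n + 2) (state π c n) (state π c' n)) (m : Fin (numBlocks π - 2)) (hm : m.1 < n) :
    c m = c' m := by
  induction n with
  | zero => omega
  | succ n ih =>
    rw [state, state, dif_pos (by omega), dif_pos (by omega)] at e
    obtain ⟨e1, e2⟩ := (isValid_state hr hπ hc (by omega)).stage_unique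
      (isValid_state hr hπ hc' (by omega)) (by omega) (by omega) (hc _).1 (hc _).2 (hc' _).1
      (hc' _).2 e
    rcases (Nat.lt_succ_iff.1 hm).eq_or_lt with h | h
    · have hmn : m = ⟨n, by omega⟩ := Fin.ext h
      rw [hmn]
      exact e1
    · exact ih (by omega) e2 h

theorem active_numBlocks_succ : active π (numBlocks π + 1) = {1} := by
  simp [active]

/-- The final splice is one more step, into the component of index `1`. No other index is active
afterwards, so a constant family can carry the result. -/
theorem psi_step (c : Fin (numBlocks π - 2) → ℕ) :
    IsSpliceStep π (numBlocks π) 1 (state π c (numBlocks π - 2)).2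
      (state π c (numBlocks π - 2)).1 fun _ => psi π c := by
  refine ⟨rfl, fun l hl hl1 => absurd ?_ hl1⟩
  rwa [active_numBlocks_succ, mem_singleton] at hl

theorem isValid_state_last (hr : 2 ≤ r) (hπ : {1} ∈ π.parts) (hc : c ∈ tupleSet π) :
    IsValid π (numBlocks π) (state π c (numBlocks π - 2)) := by
  have h := isValid_state hr hπ hc le_rfl
  rwa [Nat.sub_add_cancel (two_le_numBlocks hr hπ)] at h

theorem psi_isForest (hr : 2 ≤ r) (hπ : {1} ∈ π.parts) (hc : c ∈ tupleSet π) :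
    IsForest π (numBlocks π + 1) fun _ => psi π c := by
  have hk := two_le_numBlocks hr hπ
  have hv := isValid_state_last hr hπ hc
  exact hv.forest.step hk le_rfl one_mem_active hv.mem (hv.forest.lt_mu hk le_rfl hv.mem)
    (psi_step c)

theorem isForest_last_iff (hr : 2 ≤ r) (hπ : {1} ∈ π.parts) {T : LTree} :
    IsForest π (numBlocks π + 1) (fun _ => T) ↔ T ∈ treeSet π := by
  rw [mem_treeSet]
  constructor
  · intro h
    refine ⟨h.tree 1 one_mem_active, (h.subset 1 one_mem_active).antisymm fun x hx => ?_,
      h.compat 1 one_mem_active⟩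
    obtain ⟨j, -, hj⟩ := h.cover x hx
    exact hj
  · rintro ⟨h1, h2, h3⟩
    refine ⟨fun _ _ => h1, fun _ _ => h3, fun j hj l hl hjl => ?_, fun _ _ => h2.subset,
      fun x hx => ⟨1, one_mem_active, h2 ▸ hx⟩, fun j hj => ?_, fun j hj hj' => by omega⟩
    · rw [active_numBlocks_succ, mem_singleton] at hj hl
      exact absurd (hj.trans hl.symm) hjl
    · rw [active_numBlocks_succ, mem_singleton] at hj
      subst hj
      rw [h2]
      exact (mu_spec le_rfl (by have := two_le_numBlocks hr hπ; omega)).1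

theorem psi_bijOn (hr : 2 ≤ r) (hπ : {1} ∈ π.parts) :
    Set.BijOn (psi π) (tupleSet π) (treeSet π) := by
  have hk := two_le_numBlocks hr hπ
  refine ⟨fun c hc => (isForest_last_iff hr hπ).1 (psi_isForest hr hπ hc),
    fun c hc c' hc' e => ?_, fun T hT => ?_⟩
  · have hv := isValid_state_last hr hπ hc
    have hv' := isValid_state_last hr hπ hc'
    obtain ⟨-, e2, e3⟩ := hv.forest.step_unique hk le_rfl one_mem_active hv.mem
      (hv.forest.lt_mu hk le_rfl hv.mem) (psi_step c) hv'.forest one_mem_active hv'.mem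
      (hv'.forest.lt_mu hk le_rfl hv'.mem) (psi_step c') fun _ _ => e
    have e' : Equiv π (numBlocks π - 2 + 2) (state π c (numBlocks π - 2))
        (state π c' (numBlocks π - 2)) := by
      rw [Nat.sub_add_cancel hk]
      exact ⟨e2, e3⟩
    exact funext fun m => state_injective hr hπ hc hc' le_rfl e' m m.2
  · obtain ⟨τ, j, u, hF, hj, hu, hlt, hS⟩ :=
      ((isForest_last_iff hr hπ).2 hT).exists_step hr hπ hk le_rfl
    rw [active_numBlocks_succ, mem_singleton] at hj
    subst hj
    have hv : IsValid π (numBlocks π - 2 + 2) (τ, u) := by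
      rw [Nat.sub_add_cancel hk]
      exact ⟨hF, hu⟩
    obtain ⟨c, hc, e⟩ := exists_state hr hπ le_rfl hv
    rw [Nat.sub_add_cancel hk] at e
    refine ⟨c, hc, ?_⟩
    have := hS.eq_splice
    rw [this, psi]
    simp only [e.2 1 one_mem_active, e.2 _ (self_mem_active le_rfl), e.1]

end SetPartition

/-! ### Weights -/

namespace SetPartition

open LTree

theorem x_ne_zero (i : ℕ) : x i ≠ 0 := by
  rw [x, Ne, map_eq_zero_iff _ (IsFractionRing.injective (MvPolynomial ℕ ℤ) RatField)]
  exact MvPolynomial.X_ne_zero i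

/-- The formal variable of the father of a vertex, with the value `1` at the father `0` of the
root. -/
noncomputable def fatherVar (i : ℕ) : RatField := if i = 0 then 1 else x i

theorem fatherVar_of_ne {i : ℕ} (h : i ≠ 0) : fatherVar i = x i := if_neg h

/-- Each edge is counted at its upper end instead of its lower end. -/
theorem kappa_eq_prod {T : LTree} (hT : T.IsIncreasingTree) :
    kappa T = ∏ v ∈ T.verts, fatherVar (T.father v) := by
  have h1 : ∏ v ∈ T.verts, fatherVar (T.father v) =
      ∏ v ∈ T.verts.filter (fun v => T.father v ≠ 0), x (T.father v) := by
    rw [prod_filter]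
    refine prod_congr rfl fun v _ => ?_
    by_cases h : T.father v = 0
    · simp [h, fatherVar]
    · rw [if_pos h, fatherVar_of_ne h]
  rw [h1, ← prod_fiberwise_of_maps_to (t := T.verts) (g := T.father), kappa]
  · refine prod_congr rfl fun i hi => ?_
    rw [prod_congr rfl (g := fun _ => x i) fun v hv => by rw [(mem_filter.1 hv).2], prod_const,
      LTree.sons, filter_filter]
    congr 2
    ext v
    simp only [mem_filter]
    refine and_congr_right fun hv => ⟨fun h => ⟨?_, h⟩, fun h => h.2⟩
    rw [h]
    exact (hT.1 i hi).ne'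
  · exact fun v hv => (hT.2.2.2 v (mem_filter.1 hv).1 (mem_filter.1 hv).2).1

/-- The nonzero predecessors run through all of `K` except its maximum. -/
theorem prod_pred_mul {K : Finset ℕ} {m : ℕ} (h0 : 0 ∉ K) (hm : m ∈ K) (hmax : ∀ v ∈ K, v ≤ m) :
    (∏ v ∈ K, fatherVar (pred K v)) * x m = ∏ v ∈ K, x v := by
  induction K using Finset.induction_on_max generalizing m with
  | empty => simp at hm
  | insert a s ha ih =>
    have has : a ∉ s := fun h => lt_irrefl _ (ha a h)
    obtain rfl : m = a := by
      refine le_antisymm ?_ (hmax a (mem_insert_self _ _))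
      rcases mem_insert.1 hm with h | h
      · exact h.le
      · exact (ha m h).le
    rw [prod_insert has, prod_insert has]
    have e : ∏ v ∈ s, fatherVar (pred (insert m s) v) = ∏ v ∈ s, fatherVar (pred s v) :=
      prod_congr rfl fun v hv => by
        rw [pred_congr fun y hy => ?_]
        have := ha v hv
        rw [mem_insert, or_iff_right (by omega)]
    rw [e]
    rcases s.eq_empty_or_nonempty with rfl | hs
    · rw [pred_eq_zero (by simp)]
      simp [fatherVar]
    · have hp : pred (insert m s) m = s.max' hs := by
        refine pred_eq (mem_insert_of_mem (s.max'_mem hs)) (ha _ (s.max'_mem hs)) fun z hz hzm => ?_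
        rcases mem_insert.1 hz with h | h
        · omega
        · exact s.le_max' z h
      have h0s : 0 ∉ s := fun h => h0 (mem_insert_of_mem h)
      rw [hp, fatherVar_of_ne fun h => h0s (h ▸ s.max'_mem hs),
        ← ih h0s (s.max'_mem hs) fun v hv => s.le_max' v hv]
      ring

theorem kappa_ofChain {B : Finset ℕ} {m : ℕ} (h0 : 0 ∉ B) (hm : m ∈ B) (hmax : ∀ v ∈ B, v ≤ m) :
    kappa (ofChain B) * x m = ∏ v ∈ B, x v := by
  rw [kappa_eq_prod (ofChain_isIncreasingTree h0 ⟨m, hm⟩), ← prod_pred_mul h0 hm hmax]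
  congr 1
  exact prod_congr rfl fun v hv => by rw [show (ofChain B).father v = pred B v from if_pos hv]

theorem kappa_eq_mul {T : LTree} {v : ℕ} (hT : T.IsIncreasingTree) (hv : v ∈ T.verts) :
    kappa T * x v = (∏ u ∈ T.chainTo v, x u) *
      ∏ u ∈ T.verts \ T.chainTo v, fatherVar (T.father u) := by
  rw [kappa_eq_prod hT, ← prod_sdiff (chainTo_subset (T := T) (v := v)),
    ← prod_pred_mul (fun h => hT.zero_notMem (chainTo_subset h)) (self_mem_chainTo hv)
      fun u hu => hT.le_of_mem_chainTo hu,
    prod_congr rfl (s₁ := T.chainTo v) fun u hu => by rw [hT.father_eq_pred_of_mem hu]]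
  ring

/-- Fathers off the two chains are unchanged. The fathers along a single chain contribute all its
vertices but the last: separately `v₁` and `v₂` are missing, in the merged chain only `v₁`. -/
theorem kappa_splice {T₁ T₂ : LTree} {v₁ v₂ : ℕ} (h : Splicing T₁ v₁ T₂ v₂) (hlt : v₂ < v₁) :
    kappa (T₁.splice v₁ T₂ v₂) = kappa T₁ * kappa T₂ * x v₂ := by
  have hT := h.isIncreasingTree
  have hd : Disjoint (T₁.chainTo v₁) (T₂.chainTo v₂) :=
    h.disj.mono chainTo_subset chainTo_subset
  have hsd : (T₁.splice v₁ T₂ v₂).verts \ (T₁.chainTo v₁ ∪ T₂.chainTo v₂) =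
      (T₁.verts \ T₁.chainTo v₁) ∪ (T₂.verts \ T₂.chainTo v₂) := by
    ext u
    have h1 : u ∈ T₁.verts → u ∉ T₂.verts := fun h1 => disjoint_left.1 h.disj h1
    have h2 : u ∈ T₁.chainTo v₁ → u ∈ T₁.verts := fun h => chainTo_subset h
    have h3 : u ∈ T₂.chainTo v₂ → u ∈ T₂.verts := fun h => chainTo_subset h
    simp only [splice, mem_sdiff, mem_union]
    tauto
  apply mul_right_cancel₀ (x_ne_zero v₁)
  rw [kappa_eq_mul hT (mem_union_left _ h.mem_left), h.chainTo_top hlt, hsd, prod_union hd,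
    prod_union (h.disj.mono sdiff_subset sdiff_subset),
    prod_congr rfl (s₁ := T₁.verts \ T₁.chainTo v₁) fun u hu => by
      rw [h.father_left (mem_sdiff.1 hu).1 (mem_sdiff.1 hu).2],
    prod_congr rfl (s₁ := T₂.verts \ T₂.chainTo v₂) fun u hu => by
      rw [h.father_right (mem_sdiff.1 hu).1 (mem_sdiff.1 hu).2]]
  have e1 := kappa_eq_mul h.left h.mem_left
  have e2 := kappa_eq_mul h.right h.mem_right
  calc _ = ((∏ u ∈ T₁.chainTo v₁, x u) * ∏ u ∈ T₁.verts \ T₁.chainTo v₁, fatherVar (T₁.father u)) *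
        ((∏ u ∈ T₂.chainTo v₂, x u) * ∏ u ∈ T₂.verts \ T₂.chainTo v₂, fatherVar (T₂.father u)) := by
        ring
    _ = _ := by rw [← e1, ← e2]; ring

variable {r : ℕ} {π : Finpartition (Icc 1 r)} {i j u n : ℕ} {τ τ' : ℕ → LTree}

theorem IsForest.prod_kappa_step (h : IsForest π i τ) (h2 : 2 ≤ i) (hi : i ≤ numBlocks π)
    (hj : j ∈ active π (i + 1)) (hu : u ∈ (τ j).verts) (hlt : u < mu π i)
    (hs : IsSpliceStep π i j u τ τ') :
    ∏ l ∈ active π (i + 1), kappa (τ' l) = (∏ l ∈ active π i, kappa (τ l)) * x u := by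
  have hia : i ∉ active π (i + 1) := by
    rw [mem_active]
    omega
  have hins : active π i = insert i (active π (i + 1)) := by
    ext l
    simp only [mem_insert, mem_active]
    omega
  rw [hins, prod_insert hia, ← mul_prod_erase _ _ hj, ← mul_prod_erase _ (fun l => kappa (τ l)) hj,
    hs.eq_splice, kappa_splice (h.splicing h2 hi hj hu) hlt,
    prod_congr rfl (s₁ := (active π (i + 1)).erase j) fun l hl => by
      rw [hs.eq_of_ne l (mem_of_mem_erase hl) (ne_of_mem_erase hl)]]
  ring

theorem prod_kappa_ofChain (hr : 2 ≤ r) (hπ : {1} ∈ π.parts) :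
    (∏ l ∈ active π 2, kappa (ofChain (block π l))) * x 1 *
      ∏ i ∈ Icc 2 (numBlocks π), x (mu π i) = ∏ i ∈ Icc 1 r, x i := by
  have hk := two_le_numBlocks hr hπ
  have hF := isForest_two hk
  have h1 : (∏ l ∈ active π 2, kappa (ofChain (block π l))) * x 1 *
      ∏ i ∈ Icc 2 (numBlocks π), x (mu π i) =
      ∏ l ∈ active π 2, kappa (ofChain (block π l)) * x (mu π l) := by
    rw [prod_mul_distrib, mul_assoc]
    congr 1
    -- The factor `x 1` supplies the variable of `μ_1 = 1`.
    rw [active, prod_insert (by simp), mu_one hr hπ]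
  have h2 : ∏ l ∈ active π 2, kappa (ofChain (block π l)) * x (mu π l) =
      ∏ l ∈ active π 2, ∏ v ∈ block π l, x v := by
    refine prod_congr rfl fun l hl => ?_
    have hl' : 1 ≤ l ∧ l ≤ numBlocks π := by
      rw [mem_active] at hl
      omega
    have hb : ∀ v ∈ block π l, v ∈ Icc 1 r ∧ blockMax π v = mu π l := fun v hv =>
      (mem_block hl'.1 hl'.2).1 hv
    refine kappa_ofChain (fun h => ?_) (hF.mu_mem l hl) fun v hv => ?_
    · simpa using (hb 0 h).1
    · rw [← (hb v hv).2]
      exact le_blockMax (hb v hv).1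
  have h3 : Icc 1 r = (active π 2).biUnion fun l => block π l := by
    ext v
    rw [mem_biUnion]
    exact ⟨fun hv => hF.cover v hv, fun ⟨l, hl, hv⟩ => hF.subset l hl hv⟩
  rw [h1, h2]
  exact (prod_biUnion fun l hl m hm hlm => hF.disj l hl m hm hlm).symm.trans
    (prod_congr h3.symm fun _ _ => rfl)

/-- Each stage contributes the factor `x (c_i)` to the product of the weights of the components
and of the variable of `ν`. -/
theorem prod_kappa_state (hr : 2 ≤ r) (hπ : {1} ∈ π.parts) {c : Fin (numBlocks π - 2) → ℕ}
    (hc : c ∈ tupleSet π) (hn : n ≤ numBlocks π - 2) :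
    (∏ l ∈ active π (n + 2), kappa ((state π c n).1 l)) * x (state π c n).2 =
      (∏ l ∈ active π 2, kappa (ofChain (block π l))) * x 1 *
        ∏ m : Fin n, x (c (Fin.castLE hn m)) := by
  induction n with
  | zero => simp [state]
  | succ n ih =>
    have hv := isValid_state hr hπ hc (n := n) (by omega)
    obtain ⟨j, u, hj, hu, hlt, hs, h⟩ := hv.stage_spec (by omega) (by omega)
      (hc ⟨n, hn⟩).1 (hc ⟨n, hn⟩).2
    have e : state π c (n + 1) = stage π (n + 2) (c ⟨n, hn⟩) (state π c n) := by
      rw [state, dif_pos (by omega)]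
    have ih := ih (by omega)
    rw [Fin.prod_univ_castSucc, ← mul_assoc]
    have hcast : ∀ m : Fin n, Fin.castLE hn m.castSucc = Fin.castLE (by omega) m := fun m => rfl
    simp only [hcast]
    rw [← ih, e, show n + 1 + 2 = n + 2 + 1 by omega,
      hv.forest.prod_kappa_step (by omega) (by omega) hj hu hlt hs,
      show Fin.castLE hn (Fin.last n) = ⟨n, hn⟩ from rfl]
    -- Either the splice contributes the old `ν` and the variable of the new `ν` is that of `c`, or
    -- the splice contributes `c` and `ν` stays.
    rcases h with ⟨-, h1, h2, -⟩ | ⟨-, h1, h2⟩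
    · rw [h1, h2]
    · rw [h1, h2]
      ring

theorem kappa_psi (hr : 2 ≤ r) (hπ : {1} ∈ π.parts) {c : Fin (numBlocks π - 2) → ℕ}
    (hc : c ∈ tupleSet π) : kappa (psi π c) = omega π c := by
  have hk := two_le_numBlocks hr hπ
  have hv := isValid_state_last hr hπ hc
  have h1 := hv.forest.prod_kappa_step hk le_rfl one_mem_active hv.mem
    (hv.forest.lt_mu hk le_rfl hv.mem) (psi_step c)
  have h2 := prod_kappa_state hr hπ hc le_rfl
  rw [Nat.sub_add_cancel hk] at h2
  rw [active_numBlocks_succ, prod_singleton, h2] at h1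
  have hne : ∏ i ∈ Icc 2 (numBlocks π), x (mu π i) ≠ 0 := prod_ne_zero_iff.2 fun i _ => x_ne_zero _
  rw [h1, omega, div_mul_eq_mul_div, eq_div_iff hne, ← prod_kappa_ofChain hr hπ]
  simp only [Fin.castLE_rfl, id]
  ring

end SetPartition

theorem theorem2 (r : ℕ) (hr : 2 ≤ r) (π : Finpartition (Finset.Icc 1 r))
    (hπ : {1} ∈ π.parts) :
    Set.BijOn (SetPartition.psi π) (SetPartition.tupleSet π) (SetPartition.treeSet π) ∧
      ∀ c ∈ SetPartition.tupleSet π,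
        SetPartition.kappa (SetPartition.psi π c) = SetPartition.omega π c :=
  ⟨SetPartition.psi_bijOn hr hπ, fun _ hc => SetPartition.kappa_psi hr hπ hc⟩
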